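/- Let $p\in(0,1)$ and let $(\omega_v)_{v\in\mathbb Z_+^2}$ be i.i.d. Bernoulli$(p)$ weights on a probability space $(\Omega,\mathcal F,\mathbb P)$. For $m,n\in\mathbb Z_+$ let $$G_{m,n}=\max_{\pi}\ \sum_{i=1}^{m+n}\omega_{v_i}\,\mathbf 1\{v_i-v_{i-1}=(1,0)\},$$ where the maximum is over all paths $\pi=(v_0,\dots,v_{m+n})$ from $v_0=(0,0)$ to $v_{m+n}=(m,n)$ whose steps $v_i-v_{i-1}$ are $(1,0)$ or $(0,1)$. Fix $(s,t)\in(0,\infty)^2$ and put $$g_{pp}(s,t)=\begin{cases}\big(\sqrt{ps}+\sqrt{(1-p)t}\big)^2-t,& t<s\frac{1-p}{p},\\ s,& t\ge s\frac{1-p}{p}.\end{cases}$$ (Below $\log 0=-\infty$.) (a) The right-tail rate function $$J_{s,t}(r)=-\lim_{N\to\infty}N^{-1}\log\mathbb P\{G_{\lfloor Ns\rfloor,\lfloor Nt\rfloor}\ge Nr\},\quad 0\le r<s,\qquad J_{s,t}(s)=\lim_{r\nearrow s}J_{s,t}(r),$$ is well defined, that is, these limits exist in $[0,\infty]$. (b)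 Let $I_{s,t}(r)=J_{s,t}(r)$ for $r\in[g_{pp}(s,t),s]$ and $I_{s,t}(r)=+\infty$ for every other $r\in\mathbb R$. The distributions of $N^{-1}G_{\lfloor Ns\rfloor,\lfloor Nt\rfloor}$ satisfy a large deviation principle with normalisation $N$ and good rate function $I_{s,t}$: the function $I_{s,t}:\mathbb R\to[0,\infty]$ is lower semicontinuous, $\{r: I_{s,t}(r)\le a\}$ is compact for every $a\in\mathbb R$, and for every closed $F\subseteq\mathbb R$ and every open $H\subseteq\mathbb R$ $$\limsup_{N\to\infty}N^{-1}\log\mathbb P\{N^{-1}G_{\lfloor Ns\rfloor,\lfloor Nt\rfloor}\in F\}\le-\inf_{r\in F}I_{s,t}(r),$$ $$\liminf_{N\to\infty}N^{-1}\log\mathbb P\{N^{-1}G_{\lfloor Ns\rfloor,\lfloor Nt\rfloor}\in H\}\ge-\inf_{r\in H}I_{s,t}(r).$$ (c) On $[g_{pp}(s,t),s]$ the function $I_{s,t}$ is finite, strictly increasing, continuous and convex, and for $r\in\mathbb R$ one has $I_{s,t}(r)=0$ if and only if $r=g_{pp}(s,t)$. -/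

import Mathlib

open MeasureTheory ProbabilityTheory Filter Set
open scoped Topology ENNReal

noncomputable section

namespace BernoulliLPP

/-- `v 0, v 1, …, v (m + n)` is an admissible path from `(0, 0)` to `(m, n)`: every step is
`e₁ = (1, 0)` or `e₂ = (0, 1)`. -/
def IsAdmissiblePath (m n : ℕ) (v : Fin (m + n + 1) → ℕ × ℕ) : Prop :=
  v 0 = (0, 0) ∧ v (Fin.last (m + n)) = (m, n) ∧
    ∀ i : Fin (m + n), v i.succ = v i.castSucc + (1, 0) ∨ v i.succ = v i.castSucc + (0, 1)

/-- The weight collected by a path in the environment `w`: a horizontal step collects the weight of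
the site it moves to, a vertical step collects nothing. -/
def pathWeight (w : ℕ × ℕ → ℝ) {k : ℕ} (v : Fin (k + 1) → ℕ × ℕ) : ℝ :=
  ∑ i : Fin k, if v i.succ = v i.castSucc + (1, 0) then w (v i.succ) else 0

/-- The last passage time `G_{m,n}` in the environment `w`: the maximum of the collected weight over
the (finitely many) admissible paths from `(0, 0)` to `(m, n)`. -/
def lastPassage (w : ℕ × ℕ → ℝ) (m n : ℕ) : ℝ :=
  sSup {x : ℝ | ∃ v : Fin (m + n + 1) → ℕ × ℕ, IsAdmissiblePath m n v ∧ pathWeight w v = x}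

theorem path_mono {m n : ℕ} {v : Fin (m + n + 1) → ℕ × ℕ} (h : IsAdmissiblePath m n v) :
    Monotone v := by
  rw [Fin.monotone_iff_le_succ]
  intro i
  rcases h.2.2 i with e | e <;> rw [e] <;> exact le_self_add

theorem finite_paths (m n : ℕ) : {v | IsAdmissiblePath m n v}.Finite := by
  refine (Set.Finite.pi' (fun _ : Fin (m + n + 1) => Set.finite_Iic ((m, n) : ℕ × ℕ))).subset ?_
  intro v hv i
  have := path_mono hv (Fin.le_last i)
  rw [hv.2.1] at this
  exact this

theorem exists_path (m n : ℕ) : ∃ v, IsAdmissiblePath m n v := by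
  refine ⟨fun i => (min i.val m, i.val - m), ?_, ?_, ?_⟩
  · simp
  · simp
  · intro i
    rcases lt_or_ge i.val m with h | h
    · left
      ext <;> simp <;> omega
    · right
      ext <;> simp <;> omega

/-- The maximum in the definition of the last passage time is attained. -/
theorem lastPassage_isGreatest (w : ℕ × ℕ → ℝ) (m n : ℕ) :
    IsGreatest {x : ℝ | ∃ v : Fin (m + n + 1) → ℕ × ℕ, IsAdmissiblePath m n v ∧ pathWeight w v = x}
      (lastPassage w m n) := by
  have hf : {x : ℝ | ∃ v : Fin (m + n + 1) → ℕ × ℕ,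
      IsAdmissiblePath m n v ∧ pathWeight w v = x}.Finite := (finite_paths m n).image _
  have hn : {x : ℝ | ∃ v : Fin (m + n + 1) → ℕ × ℕ,
      IsAdmissiblePath m n v ∧ pathWeight w v = x}.Nonempty := by
    obtain ⟨v, hv⟩ := exists_path m n
    exact ⟨_, v, hv, rfl⟩
  exact ⟨hn.csSup_mem hf, fun x hx => le_csSup hf.bddAbove hx⟩

/-- The limiting shape `g_pp(s, t)` of the last passage time with i.i.d. Bernoulli(`p`) weights. -/
def shape (p s t : ℝ) : ℝ :=
  if t < s * ((1 - p) / p) then (√(p * s) + √((1 - p) * t)) ^ 2 - t else s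

variable {Ω : Type*} [MeasurableSpace Ω]

/-- `N⁻¹ log P(A)`, with value `-∞` if `P(A) = 0`. -/
def scaledLog (P : Measure Ω) (N : ℕ) (A : Set Ω) : EReal :=
  ENNReal.log (P A) / (N : EReal)

/-- `G_{⌊Ns⌋,⌊Nt⌋}` in the random environment `ω`. -/
def G (ω : ℕ × ℕ → Ω → ℝ) (s t : ℝ) (N : ℕ) (x : Ω) : ℝ :=
  lastPassage (fun v => ω v x) ⌊(N : ℝ) * s⌋₊ ⌊(N : ℝ) * t⌋₊

/-- The exponential decay rate of `P(G_{⌊Ns⌋,⌊Nt⌋} ≥ Nr)`. It is written as a lower limit, so that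
it is always defined; it is of interest where it is a limit. -/
def decayRate (P : Measure Ω) (ω : ℕ × ℕ → Ω → ℝ) (s t r : ℝ) : EReal :=
  liminf (fun N : ℕ => -scaledLog P N {x | (N : ℝ) * r ≤ G ω s t N x}) atTop

/-- The right-tail rate function `J_{s,t}(r)`, for `s, t > 0`: the decay rate of the right tail for
`r < s`, extended from the left to `r = s`, and `+∞` for `r > s`. -/
def J (P : Measure Ω) (ω : ℕ × ℕ → Ω → ℝ) (s t r : ℝ) : EReal :=
  if r < s then decayRate P ω s t r
  else if r = s then liminf (fun r' => decayRate P ω s t r') (𝓝[<] s)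
  else ⊤

open Classical in
/-- The full rate function `I_{s,t}(r)`. -/
def I (P : Measure Ω) (ω : ℕ × ℕ → Ω → ℝ) (p s t r : ℝ) : EReal :=
  if r ∈ Icc (shape p s t) s then J P ω s t r else ⊤

/-- The distributions of the real random variables `X N` satisfy the large deviation principle with
speed `N` and rate function `R`. -/
structure SatisfiesLDP (P : Measure Ω) (X : ℕ → Ω → ℝ) (R : ℝ → EReal) : Prop where
  nonneg : ∀ r, 0 ≤ R r
  lowerSemicontinuous : LowerSemicontinuous R
  upper : ∀ F : Set ℝ, IsClosed F →
    limsup (fun N : ℕ => scaledLog P N {x | X N x ∈ F}) atTop ≤ -⨅ r ∈ F, R r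
  lower : ∀ H : Set ℝ, IsOpen H →
    -⨅ r ∈ H, R r ≤ liminf (fun N : ℕ => scaledLog P N {x | X N x ∈ H}) atTop

end BernoulliLPP

end

/-!
The model is a discrete-time queue in disguise. If the two axes carry independent boundary
increments, Bernoulli(`u`) on the horizontal axis and geometric with mean
`meanQueue p u = p (1 - u) / (u - p)` on the vertical one, where `p < u < 1`, then the last passage
time has stationary increments (Burke's property). Here this is obtained from `cornerFlip`, an
involution of three coordinates that performs one step of the queue and preserves the product
measure by detailed balance (`measurePreserving_cornerFlip`); a sweep of such flips writes the
stationary last passage time at `(m, n)` as a sum of `m` Bernoulli and `n` geometric variables.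
It therefore concentrates exponentially around `m u + n meanQueue p u`
(`exists_boundaryPassage_tail`).

For `t < s (1 - p) / p` the shape function is the minimum over `u` of `s u + t meanQueue p u`; for
larger `t` it is the trivial bound `s`, and the lower bound follows by monotonicity in `t`. As the
stationary model dominates the bulk model, the optimal `u` gives an exponential bound for the right
tail beyond the shape (`exists_passage_upper_tail`). For the matching lower bound, an optimal path
of the stationary model is decomposed at the point where it leaves the axes: the bulk part after a
far exit is controlled by the upper bound with a slightly perturbed parameter, so that exits far
from the origin are suboptimal, and a path that exits close to the origin is almost a path of the
bulk model (`tendsto_passage_lower_tail`).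

The left tail decays faster than exponentially (`eventually_left_tail`): a path can be forced
through any one of `L` disjoint strips of independent blocks, so a small last passage time makes `L`
independent sums small at once, and `L` is arbitrary. Hence only the right tail matters for the
large deviations.

The right tail is supermultiplicative, by superadditivity and independence of disjoint rectangles
(`measure_mul_le_of_superadditive`), so its decay rate exists by Fekete's lemma and is convex; it
is finite since a path can follow the axis, vanishes up to the shape and is positive beyond it, and
thus strictly increasing from there on (`TailEstimates.exists_rate`). The large deviation principle
follows from these facts about the tails alone (`TailEstimates.satisfiesLDP`).
-/

namespace BernoulliLPP

/-! ### The recursion for the last passage time -/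

/-- The last passage time from the origin to `(m, n)` for a natural-number valued environment,
given by its recursion. The environment is indexed by the left endpoint of a horizontal step:
the step from `(i, j)` to `(i + 1, j)` collects `ξ (i, j)`. -/
def passage (ξ : ℕ × ℕ → ℕ) : ℕ → ℕ → ℕ
  | 0, _ => 0
  | m + 1, 0 => passage ξ m 0 + ξ (m, 0)
  | m + 1, n + 1 => max (passage ξ m (n + 1) + ξ (m, n + 1)) (passage ξ (m + 1) n)

/-- The environment seen from the site `(a, b)`. -/
def shift (a b : ℕ) (ξ : ℕ × ℕ → ℕ) : ℕ × ℕ → ℕ := fun v => ξ (v.1 + a, v.2 + b)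

@[simp]
theorem passage_zero_left (ξ : ℕ × ℕ → ℕ) (n : ℕ) : passage ξ 0 n = 0 := by
  simp [passage]

theorem passage_succ_zero (ξ : ℕ × ℕ → ℕ) (m : ℕ) :
    passage ξ (m + 1) 0 = passage ξ m 0 + ξ (m, 0) := by
  simp [passage]

theorem passage_succ_succ (ξ : ℕ × ℕ → ℕ) (m n : ℕ) : passage ξ (m + 1) (n + 1) =
    max (passage ξ m (n + 1) + ξ (m, n + 1)) (passage ξ (m + 1) n) := by
  simp [passage]

theorem passage_add_le_succ (ξ : ℕ × ℕ → ℕ) (m n : ℕ) :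
    passage ξ m n + ξ (m, n) ≤ passage ξ (m + 1) n := by
  cases n with
  | zero => exact (passage_succ_zero ξ m).ge
  | succ n => exact (le_max_left _ _).trans (passage_succ_succ ξ m n).ge

theorem passage_le_succ_right (ξ : ℕ × ℕ → ℕ) (m n : ℕ) :
    passage ξ m n ≤ passage ξ m (n + 1) := by
  cases m with
  | zero => simp
  | succ m => exact (le_max_right _ _).trans (passage_succ_succ ξ m n).ge

theorem passage_mono_left (ξ : ℕ × ℕ → ℕ) (n : ℕ) : Monotone fun m => passage ξ m n :=
  monotone_nat_of_le_succ fun m => (Nat.le_add_right _ _).trans (passage_add_le_succ ξ m n)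

theorem passage_mono_right (ξ : ℕ × ℕ → ℕ) (m : ℕ) : Monotone fun n => passage ξ m n :=
  monotone_nat_of_le_succ fun n => passage_le_succ_right ξ m n

theorem passage_congr {ξ ξ' : ℕ × ℕ → ℕ} {m n : ℕ}
    (h : ∀ i < m, ∀ j ≤ n, ξ (i, j) = ξ' (i, j)) : passage ξ m n = passage ξ' m n := by
  induction m generalizing n with
  | zero => simp
  | succ m ihm =>
    induction n with
    | zero =>
      simp only [passage_succ_zero]
      rw [ihm fun i hi j hj => h i (by omega) j hj, h m (by omega) 0 le_rfl]
    | succ n ihn =>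
      simp only [passage_succ_succ]
      rw [ihm fun i hi j hj => h i (by omega) j hj, h m (by omega) (n + 1) le_rfl,
        ihn fun i hi j hj => h i hi j (by omega)]

/-- Superadditivity: concatenate a path to `(m, n)` with a path that starts there. -/
theorem passage_add_le (ξ : ℕ × ℕ → ℕ) (m n k l : ℕ) :
    passage ξ m n + passage (shift m n ξ) k l ≤ passage ξ (m + k) (n + l) := by
  induction k generalizing l with
  | zero => simpa using passage_mono_right ξ m (Nat.le_add_right n l)
  | succ k ihk =>
    have step (l : ℕ) : passage ξ m n + (passage (shift m n ξ) k l + shift m n ξ (k, l))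
        ≤ passage ξ (m + (k + 1)) (n + l) := by
      have h1 := passage_add_le_succ ξ (m + k) (n + l)
      have h2 := ihk l
      have h3 : shift m n ξ (k, l) = ξ (m + k, n + l) := by simp [shift, add_comm]
      rw [h3, ← add_assoc m k 1]
      omega
    induction l with
    | zero => exact (passage_succ_zero (shift m n ξ) k) ▸ step 0
    | succ l ihl =>
      have h1 := step (l + 1)
      have h2 := ihl.trans (passage_le_succ_right ξ (m + (k + 1)) (n + l))
      simp only [passage_succ_succ, add_assoc] at h1 h2 ⊢
      rcases max_cases (passage (shift m n ξ) k (l + 1) + shift m n ξ (k, l + 1))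
        (passage (shift m n ξ) (k + 1) l) with h | h <;> omega

theorem passage_le {ξ : ℕ × ℕ → ℕ} (h : ∀ v, ξ v ≤ 1) (m n : ℕ) : passage ξ m n ≤ m := by
  induction m generalizing n with
  | zero => simp
  | succ m ihm =>
    induction n with
    | zero =>
      have := ihm 0
      have := h (m, 0)
      simp only [passage_succ_zero]; omega
    | succ n ihn =>
      have := ihm (n + 1)
      have := h (m, n + 1)
      simp only [passage_succ_succ]; omega

theorem passage_zero_right (ξ : ℕ × ℕ → ℕ) (m : ℕ) :
    passage ξ m 0 = ∑ i ∈ Finset.range m, ξ (i, 0) := by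
  induction m with
  | zero => simp
  | succ m ih => rw [Finset.sum_range_succ, ← ih, passage_succ_zero]

theorem pathWeight_le_passage {w : ℕ × ℕ → ℝ} {ξ : ℕ × ℕ → ℕ}
    (h : ∀ i j, w (i + 1, j) = ξ (i, j)) {k : ℕ} (v : Fin (k + 1) → ℕ × ℕ) (h0 : v 0 = (0, 0))
    (hv : ∀ i : Fin k, v i.succ = v i.castSucc + (1, 0) ∨ v i.succ = v i.castSucc + (0, 1)) :
    pathWeight w v ≤ passage ξ (v (Fin.last k)).1 (v (Fin.last k)).2 := by
  induction k with
  | zero => simp [pathWeight]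
  | succ k ih =>
    have h1 := ih (fun i => v i.castSucc) h0 fun i => hv i.castSucc
    have h2 : pathWeight w v = pathWeight w (fun i : Fin (k + 1) => v i.castSucc) +
        if v (Fin.last (k + 1)) = v (Fin.last k).castSucc + (1, 0) then
          w (v (Fin.last (k + 1))) else 0 := by
      simp only [pathWeight, Fin.sum_univ_castSucc, Fin.succ_last, Fin.succ_castSucc]
    have h3 := hv (Fin.last k)
    rw [Fin.succ_last] at h3
    rw [h2]
    rcases h3 with e | e
    · rw [if_pos e, e]
      have h4 := passage_add_le_succ ξ (v (Fin.last k).castSucc).1 (v (Fin.last k).castSucc).2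
      have h5 := h (v (Fin.last k).castSucc).1 (v (Fin.last k).castSucc).2
      simp only [Prod.fst_add, Prod.snd_add, add_zero]
      have h6 : v (Fin.last k).castSucc + (1, 0) =
        ((v (Fin.last k).castSucc).1 + 1, (v (Fin.last k).castSucc).2) := by ext <;> simp
      rw [h6, h5]
      have h7 : ((passage ξ (v (Fin.last k).castSucc).1 (v (Fin.last k).castSucc).2 : ℕ) : ℝ) +
        ξ ((v (Fin.last k).castSucc).1, (v (Fin.last k).castSucc).2) ≤
        passage ξ ((v (Fin.last k).castSucc).1 + 1) (v (Fin.last k).castSucc).2 := by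
          exact_mod_cast h4
      linarith
    · have hne : v (Fin.last (k + 1)) ≠ v (Fin.last k).castSucc + (1, 0) := by
        rw [e]; simp
      rw [if_neg hne, e, add_zero]
      refine h1.trans ?_
      simp only [Prod.fst_add, Prod.snd_add, add_zero]
      exact_mod_cast passage_le_succ_right ξ _ _

theorem exists_pathWeight_eq_passage {w : ℕ × ℕ → ℝ} {ξ : ℕ × ℕ → ℕ}
    (h : ∀ i j, w (i + 1, j) = ξ (i, j)) (k m n : ℕ) (hk : k = m + n) :
    ∃ v : Fin (k + 1) → ℕ × ℕ, v 0 = (0, 0) ∧ v (Fin.last k) = (m, n) ∧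
      (∀ i : Fin k, v i.succ = v i.castSucc + (1, 0) ∨ v i.succ = v i.castSucc + (0, 1)) ∧
      pathWeight w v = passage ξ m n := by
  induction k generalizing m n with
  | zero =>
    obtain ⟨rfl, rfl⟩ : m = 0 ∧ n = 0 := by omega
    exact ⟨fun _ => (0, 0), rfl, rfl, fun i => i.elim0, by simp [pathWeight]⟩
  | succ k ih =>
    -- append one step to an optimal path that ends at a neighbour of `(m, n)`
    have extend (m' n' : ℕ) (hk' : k = m' + n') (e : ℕ × ℕ) (he : e = (1, 0) ∨ e = (0, 1))
        (hmn : (m, n) = (m', n') + e)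
        (hw : ((passage ξ m n : ℕ) : ℝ) = passage ξ m' n' + if e = (1, 0) then w (m, n) else 0) :
        ∃ v : Fin (k + 1 + 1) → ℕ × ℕ, v 0 = (0, 0) ∧ v (Fin.last (k + 1)) = (m, n) ∧
          (∀ i : Fin (k + 1),
            v i.succ = v i.castSucc + (1, 0) ∨ v i.succ = v i.castSucc + (0, 1)) ∧
          pathWeight w v = passage ξ m n := by
      obtain ⟨v, v0, vl, vs, vw⟩ := ih m' n' hk'
      refine ⟨Fin.snoc v (m, n), ?_, by simp, ?_, ?_⟩
      · rw [← Fin.castSucc_zero, Fin.snoc_castSucc, v0]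
      · intro i
        refine Fin.lastCases ?_ (fun i => ?_) i
        · rw [Fin.succ_last, Fin.snoc_last, Fin.snoc_castSucc, vl, hmn]
          rcases he with rfl | rfl <;> simp
        · rw [Fin.succ_castSucc, Fin.snoc_castSucc, Fin.snoc_castSucc]
          exact vs i
      · rw [hw, ← vw]
        simp only [pathWeight, Fin.sum_univ_castSucc, Fin.succ_last, Fin.succ_castSucc,
          Fin.snoc_castSucc, Fin.snoc_last, vl, hmn]
        congr 1
        rcases he with rfl | rfl <;> simp
    have right (m' : ℕ) (hm : m = m' + 1) (hp : passage ξ m n = passage ξ m' n + ξ (m', n)) :=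
      extend m' n (by omega) (1, 0) (Or.inl rfl) (by simp [hm]) (by
        rw [if_pos rfl, hm, h, ← hm, hp]; push_cast; ring)
    have up (n' : ℕ) (hn : n = n' + 1) (hp : passage ξ m n = passage ξ m n') :=
      extend m n' (by omega) (0, 1) (Or.inr rfl) (by simp [hn]) (by simp [hp])
    cases m with
    | zero =>
      obtain ⟨n', rfl⟩ : ∃ n', n = n' + 1 := ⟨n - 1, by omega⟩
      exact up n' rfl (by simp)
    | succ m =>
      cases n with
      | zero => exact right m rfl (passage_succ_zero ξ m)
      | succ n =>
        rcases max_choice (passage ξ m (n + 1) + ξ (m, n + 1)) (passage ξ (m + 1) n) with e | e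
        · exact right m rfl (by rw [passage_succ_succ, e])
        · exact up n rfl (by rw [passage_succ_succ, e])

/-- The weights in the first column are never collected, hence the change of indices. -/
theorem lastPassage_eq_passage {w : ℕ × ℕ → ℝ} {ξ : ℕ × ℕ → ℕ}
    (h : ∀ i j, w (i + 1, j) = ξ (i, j)) (m n : ℕ) : lastPassage w m n = passage ξ m n := by
  refine (lastPassage_isGreatest w m n).unique ⟨?_, ?_⟩
  · obtain ⟨v, v0, vl, vs, vw⟩ := exists_pathWeight_eq_passage h (m + n) m n rfl
    exact ⟨v, ⟨v0, vl, vs⟩, vw⟩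
  · rintro x ⟨v, ⟨v0, vl, vs⟩, rfl⟩
    simpa [vl] using pathWeight_le_passage h v v0 vs

/-! ### The stationary last passage time -/

/-- The last passage time with boundary: the sites `(i + 1, 0)` and `(0, j + 1)` of `η` hold the
increments along the two axes, the sites `(i + 1, j + 1)` the weights of the bulk. -/
def boundaryPassage (η : ℕ × ℕ → ℕ) : ℕ → ℕ → ℕ
  | 0, 0 => 0
  | m + 1, 0 => boundaryPassage η m 0 + η (m + 1, 0)
  | 0, n + 1 => boundaryPassage η 0 n + η (0, n + 1)
  | m + 1, n + 1 =>
    max (boundaryPassage η m (n + 1) + η (m + 1, n + 1)) (boundaryPassage η (m + 1) n)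

theorem boundaryPassage_zero_right (η : ℕ × ℕ → ℕ) (m : ℕ) :
    boundaryPassage η m 0 = ∑ i ∈ Finset.range m, η (i + 1, 0) := by
  induction m with
  | zero => simp [boundaryPassage]
  | succ m ih => rw [Finset.sum_range_succ, ← ih]; simp [boundaryPassage]

theorem boundaryPassage_zero_left (η : ℕ × ℕ → ℕ) (n : ℕ) :
    boundaryPassage η 0 n = ∑ j ∈ Finset.range n, η (0, j + 1) := by
  induction n with
  | zero => simp [boundaryPassage]
  | succ n ih => rw [Finset.sum_range_succ, ← ih]; simp [boundaryPassage]

theorem boundaryPassage_succ_succ (η : ℕ × ℕ → ℕ) (m n : ℕ) :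
    boundaryPassage η (m + 1) (n + 1) =
      max (boundaryPassage η m (n + 1) + η (m + 1, n + 1)) (boundaryPassage η (m + 1) n) := by
  simp [boundaryPassage]

theorem passage_le_boundaryPassage (η : ℕ × ℕ → ℕ) (m n : ℕ) :
    passage (shift 1 1 η) m n ≤ boundaryPassage η m (n + 1) := by
  induction m generalizing n with
  | zero => simp
  | succ m ihm =>
    have h (n : ℕ) : passage (shift 1 1 η) m n + shift 1 1 η (m, n) ≤
        boundaryPassage η (m + 1) (n + 1) := by
      rw [boundaryPassage_succ_succ]
      exact le_max_of_le_left (Nat.add_le_add_right (ihm n) _)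
    induction n with
    | zero => rw [passage_succ_zero]; exact h 0
    | succ n ihn =>
      rw [passage_succ_succ]
      exact max_le (h (n + 1))
        (ihn.trans ((le_max_right _ _).trans (boundaryPassage_succ_succ η m (n + 1)).ge))

/-- An optimal path follows one of the two axes up to an exit point and stays in the bulk
afterwards. -/
theorem boundaryPassage_le_exit (η : ℕ × ℕ → ℕ) (m n : ℕ) :
    (∃ z k, z + k = m ∧ boundaryPassage η m (n + 1) ≤
      ∑ i ∈ Finset.range z, η (i + 1, 0) + passage (shift (z + 1) 1 η) k n) ∨
    (∃ z k, z + k = n ∧ boundaryPassage η m (n + 1) ≤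
      ∑ j ∈ Finset.range (z + 1), η (0, j + 1) + passage (shift 1 (z + 1) η) m k) := by
  induction m generalizing n with
  | zero => exact Or.inr ⟨n, 0, rfl, by simp [boundaryPassage_zero_left]⟩
  | succ m ihm =>
    have horizontal (n : ℕ)
        (h : boundaryPassage η (m + 1) (n + 1) =
          boundaryPassage η m (n + 1) + η (m + 1, n + 1)) :
        (∃ z k, z + k = m + 1 ∧ boundaryPassage η (m + 1) (n + 1) ≤
          ∑ i ∈ Finset.range z, η (i + 1, 0) + passage (shift (z + 1) 1 η) k n) ∨
        (∃ z k, z + k = n ∧ boundaryPassage η (m + 1) (n + 1) ≤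
          ∑ j ∈ Finset.range (z + 1), η (0, j + 1) + passage (shift 1 (z + 1) η) (m + 1) k) := by
      rcases ihm n with ⟨z, k, rfl, hz⟩ | ⟨z, k, rfl, hz⟩
      · refine Or.inl ⟨z, k + 1, rfl, ?_⟩
        have h1 := passage_add_le_succ (shift (z + 1) 1 η) k n
        have h2 : shift (z + 1) 1 η (k, n) = η (z + k + 1, n + 1) := by
          simp only [shift]; congr 2; omega
        omega
      · refine Or.inr ⟨z, k, rfl, ?_⟩
        have h1 := passage_add_le_succ (shift 1 (z + 1) η) m k
        have h2 : shift 1 (z + 1) η (m, k) = η (m + 1, z + k + 1) := by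
          simp only [shift]; congr 2; omega
        omega
    induction n with
    | zero =>
      rcases max_choice (boundaryPassage η m (0 + 1) + η (m + 1, 0 + 1))
        (boundaryPassage η (m + 1) 0) with e | e
      · exact horizontal 0 (by rw [boundaryPassage_succ_succ, e])
      · refine Or.inl ⟨m + 1, 0, rfl, ?_⟩
        rw [boundaryPassage_succ_succ, e, boundaryPassage_zero_right]
        exact Nat.le_add_right _ _
    | succ n ihn =>
      rcases max_choice (boundaryPassage η m (n + 1 + 1) + η (m + 1, n + 1 + 1))
        (boundaryPassage η (m + 1) (n + 1)) with e | e
      · exact horizontal (n + 1) (by rw [boundaryPassage_succ_succ, e])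
      · rw [boundaryPassage_succ_succ, e]
        rcases ihn with ⟨z, k, hk, hz⟩ | ⟨z, k, hk, hz⟩
        · exact Or.inl ⟨z, k, hk,
            hz.trans (Nat.add_le_add_left (passage_le_succ_right _ _ _) _)⟩
        · exact Or.inr ⟨z, k + 1, by omega,
            hz.trans (Nat.add_le_add_left (passage_le_succ_right _ _ _) _)⟩

/-! ### Burke's property -/

/-- One step of the queue with arrival `x c`, service `x a` and queue length `x b`: the coordinates
`a`, `b`, `c` receive the departure, the new queue length and the arrival of the reversed queue.
The step is switched off when `x a` or `x c` is not `0` or `1`, which makes it an involution on all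
of `ι → ℕ`. -/
def cornerFlip {ι : Type*} [DecidableEq ι] (a b c : ι) (x : ι → ℕ) : ι → ℕ :=
  if x a ≤ 1 ∧ x c ≤ 1 then
    Function.update (Function.update (Function.update x a (max (x c) (x a - x b)))
      b (x b + x c - x a)) c (min (x a) (x b + x c))
  else x

section cornerFlip

variable {ι : Type*} [DecidableEq ι] {a b c : ι}

theorem cornerFlip_of_ne {k : ι} (ha : k ≠ a) (hb : k ≠ b) (hc : k ≠ c) (x : ι → ℕ) :
    cornerFlip a b c x k = x k := by
  unfold cornerFlip; split_ifs <;> simp [ha, hb, hc]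

theorem cornerFlip_apply (hab : a ≠ b) (hac : a ≠ c) (hbc : b ≠ c) {x : ι → ℕ}
    (h : x a ≤ 1 ∧ x c ≤ 1) : cornerFlip a b c x a = max (x c) (x a - x b) ∧
      cornerFlip a b c x b = x b + x c - x a ∧ cornerFlip a b c x c = min (x a) (x b + x c) := by
  simp [cornerFlip, h, hab, hac, hbc]

theorem cornerFlip_involutive (hab : a ≠ b) (hac : a ≠ c) (hbc : b ≠ c) :
    Function.Involutive (cornerFlip a b c) := by
  intro x
  by_cases h : x a ≤ 1 ∧ x c ≤ 1
  · obtain ⟨e1, e2, e3⟩ := cornerFlip_apply hab hac hbc h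
    obtain ⟨f1, f2, f3⟩ := cornerFlip_apply (x := cornerFlip a b c x) hab hac hbc
      ⟨by rw [e1]; omega, by rw [e3]; omega⟩
    funext k
    by_cases hka : k = a
    · subst hka; rw [f1, e1, e2, e3]; omega
    by_cases hkb : k = b
    · subst hkb; rw [f2, e1, e2, e3]; omega
    by_cases hkc : k = c
    · subst hkc; rw [f3, e1, e2, e3]; omega
    rw [cornerFlip_of_ne hka hkb hkc, cornerFlip_of_ne hka hkb hkc]
  · have : cornerFlip a b c x = x := if_neg h
    rw [this, this]

theorem measurable_cornerFlip : Measurable (cornerFlip a b c) := by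
  unfold cornerFlip
  refine Measurable.ite ?_ ?_ measurable_id
  · exact ((measurable_pi_apply a) (MeasurableSet.of_discrete (s := Iic 1))).inter
      ((measurable_pi_apply c) (MeasurableSet.of_discrete (s := Iic 1)))
  · refine measurable_pi_iff.2 fun k => ?_
    simp only [Function.update_apply]
    split_ifs
    · exact (measurable_pi_apply a).min ((measurable_pi_apply b).add (measurable_pi_apply c))
    · exact ((measurable_pi_apply b).add (measurable_pi_apply c)).sub (measurable_pi_apply a)
    · exact (measurable_pi_apply c).max ((measurable_pi_apply a).sub (measurable_pi_apply b))
    · exact measurable_pi_apply k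

/-- Detailed balance for the queue step. -/
def Balanced (α β γ : Measure ℕ) : Prop :=
  ∀ i j w : ℕ, i ≤ 1 → w ≤ 1 →
    α {max w (i - j)} * β {j + w - i} * γ {min i (j + w)} = α {i} * β {j} * γ {w}

theorem pi_cornerFlip_singleton [Fintype ι] (μ : ι → Measure ℕ) [∀ i, IsProbabilityMeasure (μ i)]
    (hab : a ≠ b) (hac : a ≠ c) (hbc : b ≠ c) (h : Balanced (μ a) (μ b) (μ c)) (x : ι → ℕ) :
    Measure.pi μ {cornerFlip a b c x} = Measure.pi μ {x} := by
  by_cases hx : x a ≤ 1 ∧ x c ≤ 1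
  · obtain ⟨e1, e2, e3⟩ := cornerFlip_apply hab hac hbc hx
    rw [Measure.pi_singleton, Measure.pi_singleton]
    have split (f : ι → ℝ≥0∞) :
        ∏ i, f i = f a * f b * f c * ∏ i ∈ ((Finset.univ.erase a).erase b).erase c, f i := by
      rw [← Finset.mul_prod_erase Finset.univ f (Finset.mem_univ a),
        ← Finset.mul_prod_erase (Finset.univ.erase a) f (a := b) (by simp [hab.symm]),
        ← Finset.mul_prod_erase ((Finset.univ.erase a).erase b) f (a := c)
          (by simp [hac.symm, hbc.symm])]
      ring
    rw [split, split (fun i => μ i {x i}), e1, e2, e3, h _ _ _ hx.1 hx.2]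
    congr 1
    refine Finset.prod_congr rfl fun i hi => ?_
    simp only [Finset.mem_erase, Finset.mem_univ, and_true] at hi
    rw [cornerFlip_of_ne hi.2.2 hi.2.1 hi.1]
  · rw [show cornerFlip a b c x = x from if_neg hx]

theorem measurePreserving_cornerFlip_pi [Fintype ι] (μ : ι → Measure ℕ)
    [∀ i, IsProbabilityMeasure (μ i)]
    (hab : a ≠ b) (hac : a ≠ c) (hbc : b ≠ c) (h : Balanced (μ a) (μ b) (μ c)) :
    MeasurePreserving (cornerFlip a b c) (Measure.pi μ) (Measure.pi μ) := by
  refine ⟨measurable_cornerFlip, ?_⟩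
  refine Measure.ext_of_singleton fun x => ?_
  rw [Measure.map_apply measurable_cornerFlip (measurableSet_singleton x),
    ← pi_cornerFlip_singleton μ hab hac hbc h x]
  congr 1
  ext y
  simp only [mem_preimage, mem_singleton_iff]
  constructor
  · rintro rfl; exact (cornerFlip_involutive hab hac hbc y).symm
  · rintro rfl; exact cornerFlip_involutive hab hac hbc x

theorem measurePreserving_cornerFlip (μ : ι → Measure ℕ) [∀ i, IsProbabilityMeasure (μ i)]
    (hab : a ≠ b) (hac : a ≠ c) (hbc : b ≠ c) (h : Balanced (μ a) (μ b) (μ c)) :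
    MeasurePreserving (cornerFlip a b c) (Measure.infinitePi μ) (Measure.infinitePi μ) := by
  refine ⟨measurable_cornerFlip, Measure.eq_infinitePi μ fun s t ht => ?_⟩
  rw [Measure.map_apply measurable_cornerFlip
    (MeasurableSet.pi s.countable_toSet fun _ _ => ht _), ← Measure.infinitePi_pi μ fun i _ => ht i]
  -- pass to the finitely many coordinates that are involved
  set s' : Finset ι := insert a (insert b (insert c s)) with hs'
  have has : a ∈ s' := by simp [hs']
  have hbs : b ∈ s' := by simp [hs']
  have hcs : c ∈ s' := by simp [hs']
  set A : Set (∀ _ : s', ℕ) := {y | ∀ i : s', (i : ι) ∈ s → y i ∈ t i} with hA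
  have hAm : MeasurableSet A := by
    have : A = ⋂ i : s', ⋂ _ : (i : ι) ∈ s, (fun y => y i) ⁻¹' t i := by ext; simp [hA]
    rw [this]
    exact MeasurableSet.iInter fun i => MeasurableSet.iInter fun _ => measurable_pi_apply i (ht i)
  have key := measurePreserving_cornerFlip_pi (a := (⟨a, has⟩ : s')) (b := ⟨b, hbs⟩)
    (c := ⟨c, hcs⟩) (fun i : s' => μ i) (by simpa using hab) (by simpa using hac)
    (by simpa using hbc) h
  have h1 : (s : Set ι).pi t = cylinder s' A := by
    ext x
    simp only [Set.mem_pi, mem_cylinder, hA, mem_ofPred_eq, Finset.restrict, Subtype.forall]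
    exact ⟨fun h i _ hi => h i hi, fun h i hi => h i (by simp [hs', Finset.mem_coe.1 hi]) hi⟩
  have h2 : cornerFlip a b c ⁻¹' cylinder s' A =
      cylinder s' (cornerFlip (⟨a, has⟩ : s') ⟨b, hbs⟩ ⟨c, hcs⟩ ⁻¹' A) := by
    ext x
    simp only [mem_preimage, mem_cylinder]
    have : s'.restrict (cornerFlip a b c x) =
        cornerFlip (⟨a, has⟩ : s') ⟨b, hbs⟩ ⟨c, hcs⟩ (s'.restrict x) := by
      funext k
      by_cases hx : x a ≤ 1 ∧ x c ≤ 1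
      · have e : cornerFlip (⟨a, has⟩ : s') ⟨b, hbs⟩ ⟨c, hcs⟩ (s'.restrict x) = _ := if_pos hx
        rw [e]
        simp only [cornerFlip, Finset.restrict, if_pos hx, Function.update_apply, Subtype.ext_iff]
      · have e : cornerFlip (⟨a, has⟩ : s') ⟨b, hbs⟩ ⟨c, hcs⟩ (s'.restrict x) = _ := if_neg hx
        rw [e]
        simp only [cornerFlip, Finset.restrict, if_neg hx]
    rw [this]
  rw [h1, h2, Measure.infinitePi_cylinder _ (key.measurable hAm), Measure.infinitePi_cylinder _ hAm,
    key.measure_preimage hAm.nullMeasurableSet]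

end cornerFlip

/-- The state `x` of the array `η` when the corner flips have been run over the first `n` rows of
`m` columns and over the first `i` columns of the next row: the coordinates on the axes hold the
increments of `boundaryPassage η` along the current down-right path. -/
structure Sweep (η : ℕ × ℕ → ℕ) (m n i : ℕ) (x : ℕ × ℕ → ℕ) : Prop where
  le_one : ∀ k j, x (k + 1, j) ≤ 1
  left : ∀ k < i, boundaryPassage η k (n + 1) + x (k + 1, 0) = boundaryPassage η (k + 1) (n + 1)
  right : ∀ k, i ≤ k → k < m → boundaryPassage η k n + x (k + 1, 0) = boundaryPassage η (k + 1) n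
  current : boundaryPassage η i n + x (0, n + 1) = boundaryPassage η i (n + 1)
  below : ∀ j < n, boundaryPassage η m j + x (0, j + 1) = boundaryPassage η m (j + 1)
  above : ∀ j, n < j → x (0, j + 1) = η (0, j + 1)
  bulk : ∀ k j, n < j ∨ (n = j ∧ i ≤ k) → x (k + 1, j + 1) = η (k + 1, j + 1)

theorem Sweep.zero {η : ℕ × ℕ → ℕ} (h : ∀ k j, η (k + 1, j) ≤ 1) (m : ℕ) : Sweep η m 0 0 η where
  le_one := h
  left := by simp
  right := by simp [boundaryPassage]
  current := by simp [boundaryPassage]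
  below := by simp
  above := by simp
  bulk := by simp

theorem Sweep.step {η x : ℕ × ℕ → ℕ} {m n i : ℕ} (h : Sweep η m n i x) (hi : i < m) :
    Sweep η m n (i + 1) (cornerFlip (i + 1, 0) (0, n + 1) (i + 1, n + 1) x) := by
  obtain ⟨e1, e2, e3⟩ := cornerFlip_apply (a := (i + 1, 0)) (b := (0, n + 1))
    (c := (i + 1, n + 1)) (by simp) (by simp) (by simp) (x := x) ⟨h.le_one _ _, h.le_one _ _⟩
  set y := cornerFlip (i + 1, 0) (0, n + 1) (i + 1, n + 1) x with hy
  have ne {v : ℕ × ℕ} (h1 : v ≠ (i + 1, 0)) (h2 : v ≠ (0, n + 1)) (h3 : v ≠ (i + 1, n + 1)) :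
      y v = x v := cornerFlip_of_ne h1 h2 h3 x
  have hS := boundaryPassage_succ_succ η i n
  have hI := h.right i le_rfl hi
  have hJ := h.current
  have hw := h.bulk i n (Or.inr ⟨rfl, le_rfl⟩)
  have b1 := h.le_one i 0
  have b2 := h.le_one i (n + 1)
  refine ⟨fun k j => ?_, fun k hk => ?_, fun k hk hkm => ?_, ?_, fun j hj => ?_, fun j hj => ?_,
    fun k j hkj => ?_⟩
  · by_cases c1 : (k + 1, j) = (i + 1, 0)
    · rw [c1, e1]; omega
    by_cases c2 : (k + 1, j) = (i + 1, n + 1)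
    · rw [c2, e3]; omega
    rw [ne c1 (by simp) c2]; exact h.le_one k j
  · rcases Nat.lt_succ_iff_lt_or_eq.1 hk with hk | rfl
    · rw [ne (by simp; omega) (by simp) (by simp)]; exact h.left k hk
    · rw [e1]; omega
  · rw [ne (by simp; omega) (by simp) (by simp)]; exact h.right k (by omega) hkm
  · rw [e2]; omega
  · rw [ne (by simp) (by simp; omega) (by simp)]; exact h.below j hj
  · rw [ne (by simp) (by simp; omega) (by simp)]; exact h.above j hj
  · rw [ne (by simp) (by simp) (by simp; omega)]; exact h.bulk k j (by omega)

theorem Sweep.next_row {η x : ℕ × ℕ → ℕ} {m n : ℕ} (h : Sweep η m n m x) :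
    Sweep η m (n + 1) 0 x where
  le_one := h.le_one
  left := by simp
  right k _ hk := h.left k hk
  current := by
    rw [h.above (n + 1) (by omega)]; simp [boundaryPassage]
  below j hj := by
    rcases Nat.lt_succ_iff_lt_or_eq.1 hj with hj | rfl
    · exact h.below j hj
    · exact h.current
  above j hj := h.above j (by omega)
  bulk k j hkj := h.bulk k j (by omega)

theorem Sweep.boundaryPassage_eq {η x : ℕ × ℕ → ℕ} {m n : ℕ} (h : Sweep η m n 0 x) :
    boundaryPassage η m n =
      ∑ i ∈ Finset.range m, η (i + 1, 0) + ∑ j ∈ Finset.range n, x (0, j + 1) := by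
  have (k : ℕ) (hk : k ≤ n) : boundaryPassage η m k =
      ∑ i ∈ Finset.range m, η (i + 1, 0) + ∑ j ∈ Finset.range k, x (0, j + 1) := by
    induction k with
    | zero => simp [boundaryPassage_zero_right]
    | succ k ih =>
      rw [← h.below k (by omega), ih (by omega), Finset.sum_range_succ, add_assoc]
  exact this n le_rfl

/-- Burke's property: the increments of the stationary last passage time along a vertical line are
the image of the increments along the vertical axis under a measure preserving map. -/
theorem exists_measurePreserving_boundaryPassage_eq (μ : ℕ × ℕ → Measure ℕ)
    [∀ v, IsProbabilityMeasure (μ v)]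
    (h : ∀ i j, Balanced (μ (i + 1, 0)) (μ (0, j + 1)) (μ (i + 1, j + 1))) (m n : ℕ) :
    ∃ T : (ℕ × ℕ → ℕ) → ℕ × ℕ → ℕ,
      MeasurePreserving T (Measure.infinitePi μ) (Measure.infinitePi μ) ∧
      ∀ η : ℕ × ℕ → ℕ, (∀ k j, η (k + 1, j) ≤ 1) → boundaryPassage η m n =
        ∑ i ∈ Finset.range m, η (i + 1, 0) + ∑ j ∈ Finset.range n, T η (0, j + 1) := by
  have rows (n : ℕ) : ∃ T : (ℕ × ℕ → ℕ) → ℕ × ℕ → ℕ,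
      MeasurePreserving T (Measure.infinitePi μ) (Measure.infinitePi μ) ∧
      ∀ η : ℕ × ℕ → ℕ, (∀ k j, η (k + 1, j) ≤ 1) → Sweep η m n 0 (T η) := by
    induction n with
    | zero => exact ⟨id, MeasurePreserving.id _, fun η hη => Sweep.zero hη m⟩
    | succ n ih =>
      have columns (i : ℕ) (hi : i ≤ m) : ∃ T : (ℕ × ℕ → ℕ) → ℕ × ℕ → ℕ,
          MeasurePreserving T (Measure.infinitePi μ) (Measure.infinitePi μ) ∧
          ∀ η : ℕ × ℕ → ℕ, (∀ k j, η (k + 1, j) ≤ 1) → Sweep η m n i (T η) := by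
        induction i with
        | zero => exact ih
        | succ i ihi =>
          obtain ⟨T, hT, hS⟩ := ihi (by omega)
          exact ⟨_, (measurePreserving_cornerFlip μ (by simp) (by simp) (by simp) (h i n)).comp hT,
            fun η hη => (hS η hη).step (by omega)⟩
      obtain ⟨T, hT, hS⟩ := columns m le_rfl
      exact ⟨T, hT, fun η hη => (hS η hη).next_row⟩
  obtain ⟨T, hT, hS⟩ := rows n
  exact ⟨T, hT, fun η hη => (hS η hη).boundaryPassage_eq⟩

/-! ### Exponential tail bounds for sums -/

/-- The Bernoulli distribution on `ℕ`. -/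
noncomputable abbrev berLaw (q : unitInterval) : Measure ℕ := bernoulliMeasure 1 0 q

/-- The cumulant generating function of `ν` is at most `b θ + O(θ²)` near `0`; in particular
`ν` has mean `b`. -/
def HasExpBound (ν : Measure ℕ) (b : ℝ) : Prop :=
  ∃ C > 0, ∃ θ₀ > 0, ∀ θ : ℝ, |θ| ≤ θ₀ →
    ∫⁻ k, ENNReal.ofReal (Real.exp (θ * (k : ℝ))) ∂ν ≤ ENNReal.ofReal (Real.exp (b * θ + C * θ ^ 2))

theorem lintegral_berLaw (q : unitInterval) {f : ℕ → ℝ} (hf : ∀ k, 0 ≤ f k) :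
    ∫⁻ k, ENNReal.ofReal (f k) ∂(berLaw q) = ENNReal.ofReal (q * f 1 + (1 - q) * f 0) := by
  have hq := q.2
  rw [berLaw, bernoulliMeasure_def, lintegral_add_measure, ENNReal.ofReal_add
    (mul_nonneg hq.1 (hf 1)) (mul_nonneg (by linarith [hq.2]) (hf 0)),
    ENNReal.ofReal_mul hq.1, ENNReal.ofReal_mul (by linarith [hq.2])]
  congr 1
  · rw [lintegral_smul_measure, lintegral_dirac, ENNReal.smul_def, smul_eq_mul]
    congr 1
    exact (ENNReal.ofReal_eq_coe_nnreal hq.1).symm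
  · rw [lintegral_smul_measure, lintegral_dirac, ENNReal.smul_def, smul_eq_mul]
    congr 1
    exact (ENNReal.ofReal_eq_coe_nnreal (unitInterval.symm q).2.1).symm

theorem hasExpBound_berLaw (q : unitInterval) : HasExpBound (berLaw q) q := by
  have hq := q.2
  refine ⟨1, one_pos, 1, one_pos, fun θ hθ => ?_⟩
  rw [lintegral_berLaw q fun k => (Real.exp_pos _).le]
  refine ENNReal.ofReal_le_ofReal ?_
  have h1 := (abs_le.1 (Real.abs_exp_sub_one_sub_id_le hθ)).2
  have h2 := Real.add_one_le_exp (q * θ + 1 * θ ^ 2)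
  simp only [Nat.cast_one, mul_one, Nat.cast_zero, mul_zero, Real.exp_zero]
  nlinarith [hq.1, hq.2, sq_nonneg θ, mul_le_mul_of_nonneg_left h1 hq.1]

theorem hasExpBound_geometricMeasure (q : unitInterval) (hq : 0 < (q : ℝ)) :
    HasExpBound (geometricMeasure q) ((1 - q) / q) := by
  have hq1 := q.2.2
  set β : ℝ := (1 - q) / q with hβ
  have hβ0 : 0 ≤ β := div_nonneg (by linarith) hq.le
  refine ⟨β + 8 * β ^ 2 + 1, by positivity, min 1 (1 / (4 * (β + 1))), by positivity,
    fun θ hθ => ?_⟩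
  have hθ1 : |θ| ≤ 1 := hθ.trans (min_le_left _ _)
  have hθ2 : |θ| * (4 * (β + 1)) ≤ 1 :=
    (le_div_iff₀ (by positivity)).1 (hθ.trans (min_le_right _ _))
  have e1 := (abs_le.1 (Real.abs_exp_sub_one_sub_id_le hθ1)).2
  have e2 := Real.abs_exp_sub_one_le hθ1
  set y : ℝ := β * (Real.exp θ - 1) with hy
  have hy1 : y ≤ 1 / 2 := by
    have h1 : y ≤ β * (2 * |θ|) := mul_le_mul_of_nonneg_left ((le_abs_self _).trans e2) hβ0
    nlinarith [abs_nonneg θ]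
  have hden : 1 - (1 - q) * Real.exp θ = q * (1 - y) := by
    rw [hy, hβ]; field_simp; ring
  have hden0 : 0 < 1 - (1 - q) * Real.exp θ := by rw [hden]; nlinarith
  have hr0 : 0 ≤ (1 - q) * Real.exp θ := mul_nonneg (by linarith) (Real.exp_pos θ).le
  have hsum : HasSum (fun n : ℕ => ((1 - q : ℝ) ^ n * q) * Real.exp (θ * n))
      (1 / (1 - y)) := by
    have h1 := (hasSum_geometric_of_lt_one hr0 (by linarith)).mul_right (q : ℝ)
    rw [hden] at h1
    convert! h1 using 1
    · funext n
      rw [mul_pow, ← Real.exp_nat_mul, mul_comm θ]; ring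
    · field_simp
  have hint : ∫⁻ k, ENNReal.ofReal (Real.exp (θ * (k : ℝ))) ∂(geometricMeasure q) =
      ENNReal.ofReal (1 / (1 - y)) := by
    rw [geometricMeasure_eq (by intro h; simp [h] at hq), lintegral_sum_measure, ← hsum.tsum_eq,
      ENNReal.ofReal_tsum_of_nonneg _ hsum.summable]
    · congr 1
      funext n
      rw [lintegral_smul_measure, lintegral_dirac, smul_eq_mul,
        ENNReal.ofReal_mul (geometricMeasure_nonneg q n)]
    · intro n
      exact mul_nonneg (geometricMeasure_nonneg q n) (Real.exp_pos _).le
  rw [hint]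
  refine ENNReal.ofReal_le_ofReal ?_
  have hy2 : y ^ 2 ≤ 4 * β ^ 2 * θ ^ 2 := by
    have : (Real.exp θ - 1) ^ 2 ≤ (2 * |θ|) ^ 2 := by
      rw [← sq_abs (Real.exp θ - 1)]
      exact pow_le_pow_left₀ (abs_nonneg _) e2 2
    rw [mul_pow, sq_abs] at this
    rw [hy, mul_pow]
    nlinarith [sq_nonneg β]
  have hy3 : y ≤ β * θ + β * θ ^ 2 := by
    rw [hy]; nlinarith [mul_le_mul_of_nonneg_left e1 hβ0]
  have h1 : 1 / (1 - y) ≤ Real.exp (y + 2 * y ^ 2) := by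
    refine le_trans ?_ (Real.add_one_le_exp _)
    rw [div_le_iff₀ (by linarith)]
    nlinarith [sq_nonneg y]
  refine h1.trans (Real.exp_le_exp.2 ?_)
  nlinarith [sq_nonneg θ]

theorem lintegral_exp_sum {ι : Type*} (μ : ι → Measure ℕ) [∀ v, IsProbabilityMeasure (μ v)]
    {ν : Measure ℕ} {f : ℕ → ι} (hf : Function.Injective f) (hν : ∀ i, μ (f i) = ν) (θ : ℝ)
    (m : ℕ) :
    ∫⁻ η, ENNReal.ofReal (Real.exp (θ * ((∑ i ∈ Finset.range m, η (f i) : ℕ) : ℝ)))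
      ∂(Measure.infinitePi μ) = (∫⁻ k, ENNReal.ofReal (Real.exp (θ * (k : ℝ))) ∂ν) ^ m := by
  have hind : iIndepFun (fun i (η : ι → ℕ) => ENNReal.ofReal (Real.exp (θ * (η (f i) : ℝ))))
      (Measure.infinitePi μ) :=
    (iIndepFun_infinitePi (P := μ) (X := fun _ k => ENNReal.ofReal (Real.exp (θ * (k : ℝ))))
      fun _ => measurable_of_countable _).precomp hf
  have h := lintegral_prod_eq_prod_lintegral_of_indepFun (Finset.range m) _ hind
    fun i => (measurable_of_countable fun k : ℕ => ENNReal.ofReal (Real.exp (θ * (k : ℝ)))).comp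
      (measurable_pi_apply (f i))
  have h2 (i : ℕ) : ∫⁻ η, ENNReal.ofReal (Real.exp (θ * (η (f i) : ℝ))) ∂(Measure.infinitePi μ) =
      ∫⁻ k, ENNReal.ofReal (Real.exp (θ * (k : ℝ))) ∂ν := by
    rw [← hν i]
    exact (measurePreserving_eval_infinitePi μ (f i)).lintegral_comp
      (measurable_of_countable fun k : ℕ => ENNReal.ofReal (Real.exp (θ * (k : ℝ))))
  simp only [h2, Finset.prod_const, Finset.card_range] at h
  rw [← h]
  refine lintegral_congr fun η => ?_
  rw [← ENNReal.ofReal_prod_of_nonneg fun _ _ => (Real.exp_pos _).le, ← Real.exp_sum,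
    ← Finset.mul_sum]
  push_cast
  rfl

/-- The Chernoff bound. -/
theorem measureReal_ge_le_exp {Ω : Type*} [MeasurableSpace Ω] (μ : Measure Ω)
    [IsProbabilityMeasure μ] {Z : Ω → ℝ} (hZ : Measurable Z) {K : ℝ}
    (h : ∫⁻ x, ENNReal.ofReal (Real.exp (Z x)) ∂μ ≤ ENNReal.ofReal (Real.exp K)) (a : ℝ) :
    μ.real {x | a ≤ Z x} ≤ Real.exp (K - a) := by
  have h1 := mul_meas_ge_le_lintegral (μ := μ)
    (f := fun x => ENNReal.ofReal (Real.exp (Z x))) (by fun_prop) (ENNReal.ofReal (Real.exp a))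
  have h2 : {x | ENNReal.ofReal (Real.exp a) ≤ ENNReal.ofReal (Real.exp (Z x))} =
      {x | a ≤ Z x} := by
    ext x
    simp only [mem_ofPred_eq]
    rw [ENNReal.ofReal_le_ofReal_iff (Real.exp_pos _).le, Real.exp_le_exp]
  rw [h2] at h1
  have h3 := h1.trans h
  have h4 := ENNReal.toReal_mono (by simp) h3
  rw [ENNReal.toReal_mul, ENNReal.toReal_ofReal (Real.exp_pos _).le,
    ENNReal.toReal_ofReal (Real.exp_pos _).le] at h4
  rw [Real.exp_sub, le_div_iff₀ (Real.exp_pos _), mul_comm]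
  exact h4

/-- Exponential tail bounds for a sum of `m ≤ R N` independent variables at distance `δ N` from its
mean, with a rate that depends only on the common distribution. -/
theorem HasExpBound.exists_tail {ν : Measure ℕ} {b : ℝ} (h : HasExpBound ν b) {δ R : ℝ}
    (hδ : 0 < δ) (hR : 0 < R) : ∃ c > 0, ∀ (μ : ℕ × ℕ → Measure ℕ)
    [∀ v, IsProbabilityMeasure (μ v)] (f : ℕ → ℕ × ℕ), Function.Injective f →
    (∀ i, μ (f i) = ν) → ∀ N m : ℕ, (m : ℝ) ≤ R * N →
    (Measure.infinitePi μ).real {η | m * b + δ * N ≤ ((∑ i ∈ Finset.range m, η (f i) : ℕ) : ℝ)} ≤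
      Real.exp (-(c * N)) ∧
    (Measure.infinitePi μ).real {η | ((∑ i ∈ Finset.range m, η (f i) : ℕ) : ℝ) ≤ m * b - δ * N} ≤
      Real.exp (-(c * N)) := by
  obtain ⟨C, hC, θ₀, hθ₀, hb⟩ := h
  -- optimise `-θ δ N + C θ² R N` up to a constant
  set θ := min θ₀ (δ / (2 * C * R)) with hθ
  have hθpos : 0 < θ := by positivity
  have hθ1 : C * θ * R ≤ δ / 2 := by
    have := (le_div_iff₀ (by positivity)).1 (min_le_right θ₀ (δ / (2 * C * R)))
    rw [← hθ] at this; linarith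
  refine ⟨θ * δ / 2, by positivity, fun μ _ f hf hν N m hm => ?_⟩
  have key (σ : ℝ) (hσ : |σ| = θ) :
      (Measure.infinitePi μ).real {η | σ * (m * b) + θ * δ * N ≤
        σ * ((∑ i ∈ Finset.range m, η (f i) : ℕ) : ℝ)} ≤ Real.exp (-(θ * δ / 2 * N)) := by
    have h1 : ∫⁻ η, ENNReal.ofReal (Real.exp (σ * ((∑ i ∈ Finset.range m, η (f i) : ℕ) : ℝ)))
        ∂(Measure.infinitePi μ) ≤ ENNReal.ofReal (Real.exp (m * (b * σ + C * σ ^ 2))) := by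
      rw [lintegral_exp_sum μ hf hν, Real.exp_nat_mul, ENNReal.ofReal_pow (Real.exp_pos _).le]
      exact pow_le_pow_left₀ zero_le (hb σ (hσ ▸ min_le_left _ _)) m
    have hmeas : Measurable fun η : ℕ × ℕ → ℕ =>
        σ * ((∑ i ∈ Finset.range m, η (f i) : ℕ) : ℝ) :=
      ((measurable_of_countable (fun k : ℕ => (k : ℝ))).comp
        (Finset.measurable_sum _ fun i _ => measurable_pi_apply (f i))).const_mul σ
    refine (measureReal_ge_le_exp _ hmeas h1 _).trans (Real.exp_le_exp.2 ?_)
    have hσ2 : σ ^ 2 = θ ^ 2 := by rw [← sq_abs, hσ]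
    have h2 : C * θ ^ 2 * m ≤ C * θ ^ 2 * (R * N) :=
      mul_le_mul_of_nonneg_left hm (by positivity)
    have h3 : (C * θ * R) * (θ * N) ≤ δ / 2 * (θ * N) :=
      mul_le_mul_of_nonneg_right hθ1 (by positivity)
    rw [hσ2]
    nlinarith
  constructor
  · refine (measureReal_mono fun η hη => ?_).trans (key θ (abs_of_pos hθpos))
    simp only [mem_ofPred_eq] at hη ⊢
    nlinarith
  · refine (measureReal_mono fun η hη => ?_).trans (key (-θ) (by rw [abs_neg, abs_of_pos hθpos]))
    simp only [mem_ofPred_eq] at hη ⊢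
    nlinarith

/-! ### The bulk and the stationary environment -/

/-- The law of an environment of i.i.d. Bernoulli weights. -/
noncomputable def bulkLaw (p : unitInterval) : Measure (ℕ × ℕ → ℕ) :=
  Measure.infinitePi fun _ => berLaw p

/-- The marginals of the environment with boundary for which the last passage time has stationary
increments: Bernoulli(`u`) on the horizontal axis, Bernoulli(`p`) in the bulk, and on the vertical
axis the equilibrium queue length for arrival rate `p` and service rate `u`, which is geometric. -/
noncomputable def boundaryLaw (p u : unitInterval) : ℕ × ℕ → Measure ℕ
  | (0, _) => geometricMeasure (projIcc 0 1 zero_le_one (((u : ℝ) - p) / (u * (1 - p))))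
  | (_ + 1, 0) => berLaw u
  | (_ + 1, _ + 1) => berLaw p

/-- The mean queue length for arrival rate `p` and service rate `u`. -/
noncomputable def meanQueue (p u : ℝ) : ℝ := p * (1 - u) / (u - p)

instance (p : unitInterval) : IsProbabilityMeasure (bulkLaw p) := by
  unfold bulkLaw; infer_instance

instance (p u : unitInterval) (v : ℕ × ℕ) : IsProbabilityMeasure (boundaryLaw p u v) := by
  rcases v with ⟨_ | i, _ | j⟩ <;> simp only [boundaryLaw] <;> infer_instance

theorem berLaw_singleton_zero (q : unitInterval) : berLaw q {0} = ENNReal.ofReal (1 - q) := by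
  rw [berLaw, bernoulliMeasure_apply_of_notMem_of_mem _ (by measurability) (by simp) (by simp)]
  exact (ENNReal.ofReal_eq_coe_nnreal (unitInterval.symm q).2.1).symm

theorem berLaw_singleton_one (q : unitInterval) : berLaw q {1} = ENNReal.ofReal q := by
  rw [berLaw, bernoulliMeasure_apply_of_mem_of_notMem _ (by measurability) (by simp) (by simp)]
  exact (ENNReal.ofReal_eq_coe_nnreal q.2.1).symm

theorem ae_berLaw_le_one (q : unitInterval) : ∀ᵐ k ∂(berLaw q), k ≤ 1 := by
  rw [ae_iff, berLaw, bernoulliMeasure_apply_of_notMem_of_notMem _ .of_discrete (by simp) (by simp)]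

theorem balanced_geometricMeasure {p u q : unitInterval} (hq : 0 < (q : ℝ))
    (h : (1 - q : ℝ) * u * (1 - p) = p * (1 - u)) :
    Balanced (berLaw u) (geometricMeasure q) (berLaw p) := by
  have hq0 : q ≠ 0 := by rintro rfl; simp at hq
  have hu := u.2
  have hp := p.2
  -- the only nontrivial transition exchanges an arrival with a service
  have key (j : ℕ) : berLaw u {1} * geometricMeasure q {j + 1} * berLaw p {0} =
      berLaw u {0} * geometricMeasure q {j} * berLaw p {1} := by
    have hg (n : ℕ) := geometricMeasure_nonneg q n
    rw [berLaw_singleton_zero, berLaw_singleton_zero, berLaw_singleton_one, berLaw_singleton_one,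
      geometricMeasure_singleton hq0, geometricMeasure_singleton hq0,
      ← ENNReal.ofReal_mul hu.1, ← ENNReal.ofReal_mul (mul_nonneg hu.1 (hg _)),
      ← ENNReal.ofReal_mul (by linarith [hu.2]),
      ← ENNReal.ofReal_mul (mul_nonneg (by linarith [hu.2]) (hg _))]
    congr 1
    rw [pow_succ]
    linear_combination (1 - q : ℝ) ^ j * q * h
  intro i j w hi hw
  interval_cases i <;> interval_cases w
  · simp
  · simpa using key j
  · rcases j with _ | j
    · simp
    · simpa using (key j).symm
  · simp

section boundaryLaw

variable {p u : unitInterval}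

theorem boundaryLaw_zero (hp0 : 0 < (p : ℝ)) (hpu : (p : ℝ) < u) (hu1 : (u : ℝ) < 1) :
    ∃ q : unitInterval, (∀ j, boundaryLaw p u (0, j) = geometricMeasure q) ∧ 0 < (q : ℝ) ∧
      (1 - q : ℝ) * u * (1 - p) = p * (1 - u) ∧ (1 - q : ℝ) / q = meanQueue p u := by
  have hu0 : (0 : ℝ) < u := hp0.trans hpu
  have hp1 : (0 : ℝ) < 1 - p := by linarith
  have hup : (0 : ℝ) < u - p := by linarith
  have hmem : ((u : ℝ) - p) / (u * (1 - p)) ∈ Icc (0 : ℝ) 1 :=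
    ⟨by positivity, by rw [div_le_one (by positivity)]; nlinarith⟩
  refine ⟨⟨_, hmem⟩, fun j => ?_, ?_, ?_, ?_⟩
  · simp only [boundaryLaw]; rw [projIcc_of_mem _ hmem]
  · simp only; positivity
  · simp only; field_simp; ring
  · simp only [meanQueue]; field_simp; ring

theorem ae_boundaryLaw_le_one (p u : unitInterval) :
    ∀ᵐ η ∂(Measure.infinitePi (boundaryLaw p u)), ∀ k j, η (k + 1, j) ≤ 1 := by
  refine ae_all_iff.2 fun k => ae_all_iff.2 fun j => ?_
  refine (measurePreserving_eval_infinitePi (boundaryLaw p u)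
    (k + 1, j)).quasiMeasurePreserving.ae (p := fun x => x ≤ 1) ?_
  rcases j with _ | j <;> exact ae_berLaw_le_one _

theorem ae_bulkLaw_le_one (p : unitInterval) : ∀ᵐ ξ ∂(bulkLaw p), ∀ v, ξ v ≤ 1 :=
  ae_all_iff.2 fun v => (measurePreserving_eval_infinitePi (fun _ => berLaw p)
    v).quasiMeasurePreserving.ae (p := fun x => x ≤ 1) (ae_berLaw_le_one _)

theorem measurePreserving_shift_boundaryLaw (p u : unitInterval) (a b : ℕ) :
    MeasurePreserving (shift (a + 1) (b + 1)) (Measure.infinitePi (boundaryLaw p u))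
      (bulkLaw p) := by
  refine ⟨measurable_pi_iff.2 fun v => measurable_pi_apply _, ?_⟩
  exact Measure.map_infinitePi_infinitePi_of_inj (P := boundaryLaw p u)
    (f := fun v : ℕ × ℕ => (v.1 + (a + 1), v.2 + (b + 1)))
    fun v w h => by simp only [Prod.mk.injEq] at h; ext <;> omega

theorem measurePreserving_shift_bulkLaw (p : unitInterval) (a b : ℕ) :
    MeasurePreserving (shift a b) (bulkLaw p) (bulkLaw p) := by
  refine ⟨measurable_pi_iff.2 fun v => measurable_pi_apply _, ?_⟩
  exact Measure.map_infinitePi_infinitePi_of_inj (P := fun _ : ℕ × ℕ => berLaw p)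
    (f := fun v : ℕ × ℕ => (v.1 + a, v.2 + b))
    fun v w h => by simp only [Prod.mk.injEq] at h; ext <;> omega

theorem measurable_passage (m n : ℕ) : Measurable fun ξ => passage ξ m n := by
  induction m generalizing n with
  | zero => simp
  | succ m ihm =>
    induction n with
    | zero => simp only [passage_succ_zero]; exact (ihm 0).add (measurable_pi_apply _)
    | succ n ihn =>
      simp only [passage_succ_succ]
      exact ((ihm (n + 1)).add (measurable_pi_apply _)).max ihn

theorem exists_horizontal_tail (p u : unitInterval) {δ R : ℝ} (hδ : 0 < δ) (hR : 0 < R) :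
    ∃ c > 0, ∀ N m : ℕ, (m : ℝ) ≤ R * N →
      (Measure.infinitePi (boundaryLaw p u)).real
        {η | m * (u : ℝ) + δ * N ≤ ((∑ i ∈ Finset.range m, η (i + 1, 0) : ℕ) : ℝ)} ≤
          Real.exp (-(c * N)) ∧
      (Measure.infinitePi (boundaryLaw p u)).real
        {η | ((∑ i ∈ Finset.range m, η (i + 1, 0) : ℕ) : ℝ) ≤ m * u - δ * N} ≤
          Real.exp (-(c * N)) := by
  obtain ⟨c, hc, h⟩ := (hasExpBound_berLaw u).exists_tail hδ hR
  exact ⟨c, hc, fun N m hm => h (boundaryLaw p u) (fun i => (i + 1, 0))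
    (fun i j hij => by simpa using hij) (fun i => rfl) N m hm⟩

theorem exists_vertical_tail (hp0 : 0 < (p : ℝ)) (hpu : (p : ℝ) < u) (hu1 : (u : ℝ) < 1)
    {δ R : ℝ} (hδ : 0 < δ) (hR : 0 < R) :
    ∃ c > 0, ∀ N n : ℕ, (n : ℝ) ≤ R * N →
      (Measure.infinitePi (boundaryLaw p u)).real
        {η | n * meanQueue p u + δ * N ≤ ((∑ j ∈ Finset.range n, η (0, j + 1) : ℕ) : ℝ)} ≤
          Real.exp (-(c * N)) ∧
      (Measure.infinitePi (boundaryLaw p u)).real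
        {η | ((∑ j ∈ Finset.range n, η (0, j + 1) : ℕ) : ℝ) ≤ n * meanQueue p u - δ * N} ≤
          Real.exp (-(c * N)) := by
  obtain ⟨q, hq, hq0, -, hq2⟩ := boundaryLaw_zero hp0 hpu hu1
  obtain ⟨c, hc, h⟩ := (hasExpBound_geometricMeasure q hq0).exists_tail hδ hR
  rw [hq2] at h
  exact ⟨c, hc, fun N m hm => h (boundaryLaw p u) (fun j => (0, j + 1))
    (fun i j hij => by simpa using hij) (fun i => hq _) N m hm⟩

theorem measureReal_le_add_of_ae {Ω : Type*} [MeasurableSpace Ω] {μ : Measure Ω}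
    [IsFiniteMeasure μ] {A B C : Set Ω} (h : ∀ᵐ x ∂μ, x ∈ A → x ∈ B ∪ C) :
    μ.real A ≤ μ.real B + μ.real C :=
  (ENNReal.toReal_mono (measure_ne_top _ _) (measure_mono_ae h)).trans (measureReal_union_le B C)

/-- By Burke's property the stationary last passage time is a sum of two sums of independent
variables, so that it concentrates exponentially around its mean. -/
theorem exists_boundaryPassage_tail (hp0 : 0 < (p : ℝ)) (hpu : (p : ℝ) < u) (hu1 : (u : ℝ) < 1)
    {δ R : ℝ} (hδ : 0 < δ) (hR : 0 < R) :
    ∃ c > 0, ∀ N m n : ℕ, (m : ℝ) ≤ R * N → (n : ℝ) ≤ R * N →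
      (Measure.infinitePi (boundaryLaw p u)).real
        {η | m * (u : ℝ) + n * meanQueue p u + δ * N ≤ (boundaryPassage η m n : ℝ)} ≤
          2 * Real.exp (-(c * N)) ∧
      (Measure.infinitePi (boundaryLaw p u)).real
        {η | (boundaryPassage η m n : ℝ) ≤ m * u + n * meanQueue p u - δ * N} ≤
          2 * Real.exp (-(c * N)) := by
  obtain ⟨c₁, hc₁, h₁⟩ := exists_horizontal_tail p u (half_pos hδ) hR
  obtain ⟨c₂, hc₂, h₂⟩ := exists_vertical_tail hp0 hpu hu1 (half_pos hδ) hR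
  obtain ⟨q, hq, hq0, hq1, -⟩ := boundaryLaw_zero hp0 hpu hu1
  have hbal (i j : ℕ) : Balanced (boundaryLaw p u (i + 1, 0)) (boundaryLaw p u (0, j + 1))
      (boundaryLaw p u (i + 1, j + 1)) := by
    rw [hq]; exact balanced_geometricMeasure hq0 hq1
  refine ⟨min c₁ c₂, lt_min hc₁ hc₂, fun N m n hm hn => ?_⟩
  have e₁ : Real.exp (-(c₁ * N)) ≤ Real.exp (-(min c₁ c₂ * N)) :=
    Real.exp_le_exp.2 (neg_le_neg (mul_le_mul_of_nonneg_right (min_le_left _ _) N.cast_nonneg))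
  have e₂ : Real.exp (-(c₂ * N)) ≤ Real.exp (-(min c₁ c₂ * N)) :=
    Real.exp_le_exp.2 (neg_le_neg (mul_le_mul_of_nonneg_right (min_le_right _ _) N.cast_nonneg))
  obtain ⟨T, hT, hS⟩ := exists_measurePreserving_boundaryPassage_eq (boundaryLaw p u) hbal m n
  have hmeas : Measurable fun η : ℕ × ℕ → ℕ => ((∑ j ∈ Finset.range n, η (0, j + 1) : ℕ) : ℝ) :=
    (measurable_of_countable (fun k : ℕ => (k : ℝ))).comp
      (Finset.measurable_sum _ fun i _ => measurable_pi_apply _)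
  obtain ⟨h₁u, h₁l⟩ := h₁ N m hm
  obtain ⟨h₂u, h₂l⟩ := h₂ N n hn
  rw [← hT.measureReal_preimage (measurableSet_le measurable_const hmeas).nullMeasurableSet] at h₂u
  rw [← hT.measureReal_preimage (measurableSet_le hmeas measurable_const).nullMeasurableSet] at h₂l
  constructor
  · refine (measureReal_le_add_of_ae ?_).trans
      ((add_le_add (h₁u.trans e₁) (h₂u.trans e₂)).trans_eq (two_mul _).symm)
    filter_upwards [ae_boundaryLaw_le_one p u] with η hη h
    simp only [mem_ofPred_eq, hS η hη, mem_union, mem_preimage, Nat.cast_add] at h ⊢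
    by_contra! hcon
    linarith [hcon.1, hcon.2]
  · refine (measureReal_le_add_of_ae ?_).trans
      ((add_le_add (h₁l.trans e₁) (h₂l.trans e₂)).trans_eq (two_mul _).symm)
    filter_upwards [ae_boundaryLaw_le_one p u] with η hη h
    simp only [mem_ofPred_eq, hS η hη, mem_union, mem_preimage, Nat.cast_add] at h ⊢
    by_contra! hcon
    linarith [hcon.1, hcon.2]

/-- Comparison with the stationary last passage time bounds the upper tail. -/
theorem exists_passage_upper_tail (hp0 : 0 < (p : ℝ)) (hpu : (p : ℝ) < u) (hu1 : (u : ℝ) < 1)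
    {δ R : ℝ} (hδ : 0 < δ) (hR : 0 < R) :
    ∃ c > 0, ∀ N m n : ℕ, (m : ℝ) ≤ R * N → (n : ℝ) + 1 ≤ R * N →
      (bulkLaw p).real {ξ | m * (u : ℝ) + (n + 1) * meanQueue p u + δ * N ≤ (passage ξ m n : ℝ)} ≤
        2 * Real.exp (-(c * N)) := by
  obtain ⟨c, hc, h⟩ := exists_boundaryPassage_tail hp0 hpu hu1 hδ hR
  refine ⟨c, hc, fun N m n hm hn => ?_⟩
  have hmeas : Measurable fun ξ => (passage ξ m n : ℝ) :=
    (measurable_of_countable (fun k : ℕ => (k : ℝ))).comp (measurable_passage m n)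
  rw [← (measurePreserving_shift_boundaryLaw p u 0 0).measureReal_preimage
    (measurableSet_le measurable_const hmeas).nullMeasurableSet]
  refine (measureReal_mono fun η hη => ?_).trans (h N m (n + 1) hm (by exact_mod_cast hn)).1
  simp only [mem_ofPred_eq, mem_preimage] at hη ⊢
  push_cast
  exact hη.trans (by exact_mod_cast passage_le_boundaryPassage η m n)

end boundaryLaw

/-! ### The limiting shape -/

theorem meanQueue_add {p x : ℝ} (hx : x ≠ 0) : meanQueue p (p + x) = p * (1 - p) / x - p := by
  rw [meanQueue, add_sub_cancel_left, eq_sub_iff_add_eq, div_add' _ _ _ hx]; congr 1; ring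

/-- The shape function is the mean of the stationary last passage time at the parameter `p + x`
that minimises this mean. -/
theorem exists_optimal_parameter {p s t : ℝ} (hp0 : 0 < p) (hp1 : p < 1) (hs : 0 < s) (ht : 0 < t)
    (hst : t < s * ((1 - p) / p)) : ∃ x, 0 < x ∧ x < 1 - p ∧ s * x ^ 2 = t * (p * (1 - p)) ∧
      shape p s t = s * (p + x) + t * meanQueue p (p + x) := by
  have hq : 0 < 1 - p := by linarith
  have hst' : t * p < s * (1 - p) := by
    rw [← mul_div_assoc, lt_div_iff₀ hp0] at hst; exact hst
  set x := √(t * (p * (1 - p)) / s) with hx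
  have hx2 : s * x ^ 2 = t * (p * (1 - p)) := by
    rw [hx, Real.sq_sqrt (by positivity)]; field_simp
  have hx0 : 0 < x := by rw [hx]; positivity
  refine ⟨x, hx0, ?_, hx2, ?_⟩
  · by_contra! h
    have h1 : (1 - p) ^ 2 ≤ x ^ 2 := pow_le_pow_left₀ hq.le h 2
    nlinarith [mul_le_mul_of_nonneg_left h1 hs.le, mul_lt_mul_of_pos_right hst' hq]
  · have h1 : √(p * s) * √((1 - p) * t) = s * x := by
      rw [← Real.sqrt_mul (by positivity), ← Real.sqrt_sq (show 0 ≤ s * x by positivity)]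
      congr 1; rw [mul_pow]; linear_combination (-s) * hx2
    have h2 : t * (p * (1 - p) / x) = s * x := by
      rw [← mul_div_assoc, div_eq_iff hx0.ne']; linear_combination -hx2
    rw [shape, if_pos hst, add_sq, Real.sq_sqrt (by positivity), Real.sq_sqrt (by positivity),
      meanQueue_add hx0.ne']
    linear_combination 2 * h1 - h2

/-- A path that exits far out on the horizontal axis is beaten by a parameter larger than the
optimal one. -/
theorem exists_horizontal_gap {p s t x ε : ℝ} (hp0 : 0 < p) (hs : 0 < s) (hx0 : 0 < x)
    (hx1 : x < 1 - p) (hx : s * x ^ 2 = t * (p * (1 - p))) (hε : 0 < ε) :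
    ∃ u, p + x < u ∧ u < 1 ∧ meanQueue p u ≤ meanQueue p (p + x) ∧
      0 < (s - ε) * (p + x - u) + t * (meanQueue p (p + x) - meanQueue p u) := by
  set η := min (ε * x / (2 * s)) ((1 - p - x) / 2) with hη
  have hη0 : 0 < η := lt_min (by positivity) (by linarith)
  have hη1 : η ≤ (1 - p - x) / 2 := min_le_right _ _
  have hη2 : η * (2 * s) ≤ ε * x := (le_div_iff₀ (by positivity)).1 (min_le_left _ _)
  have hp1 : 0 < 1 - p := by linarith
  have e : p + x + η = p + (x + η) := by ring
  have hd : p * (1 - p) / x - p * (1 - p) / (x + η) = p * (1 - p) * η / (x * (x + η)) := by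
    field_simp; ring
  refine ⟨p + x + η, by linarith, by linarith, ?_, ?_⟩
  · rw [e, meanQueue_add (show x + η ≠ 0 by positivity), meanQueue_add hx0.ne']
    have : 0 ≤ p * (1 - p) * η / (x * (x + η)) := by positivity
    linarith
  · rw [e, meanQueue_add (show x + η ≠ 0 by positivity), meanQueue_add hx0.ne']
    have h1 : (s - ε) * (p + x - (p + (x + η))) +
        t * (p * (1 - p) / x - p - (p * (1 - p) / (x + η) - p)) =
        η / (x + η) * (ε * (x + η) - s * η) := by
      have : t * (p * (1 - p) / x - p - (p * (1 - p) / (x + η) - p)) =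
          s * x ^ 2 * η / (x * (x + η)) := by
        rw [hx]; linear_combination t * hd
      rw [this]; field_simp; ring
    rw [h1]
    refine mul_pos (by positivity) ?_
    nlinarith [mul_pos hε hη0, mul_pos hs hη0]

/-- A path that exits far out on the vertical axis is beaten by a parameter smaller than the
optimal one. -/
theorem exists_vertical_gap {p s t x ε : ℝ} (hp0 : 0 < p) (hs : 0 < s) (hx0 : 0 < x)
    (hx1 : x < 1 - p) (hx : s * x ^ 2 = t * (p * (1 - p))) (hε : 0 < ε) :
    ∃ u, p < u ∧ u < p + x ∧ meanQueue p (p + x) ≤ meanQueue p u ∧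
      0 < s * (p + x - u) + (t - ε) * (meanQueue p (p + x) - meanQueue p u) := by
  have hp1 : 0 < 1 - p := by linarith
  set η := min (ε * (p * (1 - p)) / (2 * (s * x))) (x / 2) with hη
  have hη0 : 0 < η := lt_min (by positivity) (by linarith)
  have hη1 : η ≤ x / 2 := min_le_right _ _
  have hη2 : η * (2 * (s * x)) ≤ ε * (p * (1 - p)) :=
    (le_div_iff₀ (by positivity)).1 (min_le_left _ _)
  have hy : 0 < x - η := by linarith
  have e : p + x - η = p + (x - η) := by ring
  have hd : p * (1 - p) / (x - η) - p * (1 - p) / x = p * (1 - p) * η / (x * (x - η)) := by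
    field_simp; ring
  have hd0 : 0 ≤ p * (1 - p) * η / (x * (x - η)) := by positivity
  refine ⟨p + x - η, by linarith, by linarith, ?_, ?_⟩
  · rw [e, meanQueue_add hy.ne', meanQueue_add hx0.ne']
    linarith
  · rw [e, meanQueue_add hy.ne', meanQueue_add hx0.ne']
    have h1 : s * (p + x - (p + (x - η))) +
        (t - ε) * (p * (1 - p) / x - p - (p * (1 - p) / (x - η) - p)) =
        η / (x * (x - η)) * (ε * (p * (1 - p)) - s * x * η) := by
      have : (t - ε) * (p * (1 - p) / x - p - (p * (1 - p) / (x - η) - p)) =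
          (ε * (p * (1 - p)) - s * x ^ 2) * η / (x * (x - η)) := by
        rw [hx]; linear_combination (ε - t) * hd
      rw [this]; field_simp; ring
    rw [h1]
    refine mul_pos (by positivity) ?_
    nlinarith [mul_pos (mul_pos hs hx0) hη0]

theorem passage_shift_horizontal_le (η : ℕ × ℕ → ℕ) (z k n : ℕ) :
    passage (shift (z + 1) 1 η) k n ≤ passage (shift 1 1 η) (z + k) n := by
  have h := passage_add_le (shift 1 1 η) z 0 k n
  have e : shift z 0 (shift 1 1 η) = shift (z + 1) 1 η := by
    funext v; simp [shift, add_assoc]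
  rw [e, zero_add] at h
  omega

theorem passage_shift_vertical_le (η : ℕ × ℕ → ℕ) (z k m : ℕ) :
    passage (shift 1 (z + 1) η) m k ≤ passage (shift 1 1 η) m (z + k) := by
  have h := passage_add_le (shift 1 1 η) 0 z m k
  have e : shift 0 z (shift 1 1 η) = shift 1 (z + 1) η := by
    funext v; simp [shift, add_assoc]
  rw [e, zero_add] at h
  simpa using h

theorem tendsto_affine_mul_exp_neg (A : ℝ) {c : ℝ} (hc : 0 < c) :
    Tendsto (fun N : ℕ => (A * N + A) * Real.exp (-(c * N))) atTop (𝓝 0) := by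
  have h1 : Tendsto (fun N : ℕ => c * (N : ℝ)) atTop atTop :=
    tendsto_natCast_atTop_atTop.const_mul_atTop hc
  have h2 := (Real.tendsto_pow_mul_exp_neg_atTop_nhds_zero 1).comp h1
  have h3 := Real.tendsto_exp_neg_atTop_nhds_zero.comp h1
  have h4 := (h2.const_mul (A / c)).add (h3.const_mul A)
  simp only [mul_zero, add_zero] at h4
  refine h4.congr fun N => ?_
  simp only [Function.comp, pow_one]
  field_simp

/-- If no term of the exit decomposition is much larger than its mean, and exits at distance
more than `d` from the origin are suboptimal on average, then the optimal exit point is close to the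
origin, and the bulk last passage time is almost as large as the stationary one. -/
theorem lt_passage_of_exit {η : ℕ × ℕ → ℕ} {m n : ℕ} {u β u₁ β₁ u₂ β₂ e d x : ℝ}
    (hS : m * u + (n + 1) * β - e < boundaryPassage η m (n + 1))
    (hH : ∀ z ≤ m, ((∑ i ∈ Finset.range z, η (i + 1, 0) : ℕ) : ℝ) < z * u + e ∧
      (passage (shift (z + 1) 1 η) (m - z) n : ℝ) < (m - z : ℕ) * u₁ + (n + 1) * β₁ + e)
    (hV : ∀ z ≤ n, ((∑ j ∈ Finset.range (z + 1), η (0, j + 1) : ℕ) : ℝ) < (z + 1 : ℕ) * β + e ∧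
      (passage (shift 1 (z + 1) η) m (n - z) : ℝ) < m * u₂ + ((n - z : ℕ) + 1) * β₂ + e)
    (farH : ∀ z ≤ m, d ≤ z →
      z * u + (m - z : ℕ) * u₁ + (n + 1) * β₁ + 3 * e ≤ m * u + (n + 1) * β)
    (farV : ∀ z ≤ n, d ≤ z →
      (z + 1 : ℕ) * β + m * u₂ + ((n - z : ℕ) + 1) * β₂ + 3 * e ≤ m * u + (n + 1) * β)
    (nearH : ∀ z : ℕ, z ≤ d → z * u + 2 * e + x ≤ m * u + (n + 1) * β)
    (nearV : ∀ z : ℕ, z ≤ d → (z + 1 : ℕ) * β + 2 * e + x ≤ m * u + (n + 1) * β) :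
    x < passage (shift 1 1 η) m n := by
  rcases boundaryPassage_le_exit η m n with ⟨z, k, hzk, hz⟩ | ⟨z, k, hzk, hz⟩
  · obtain ⟨h1, h2⟩ := hH z (by omega)
    have hz2 : ((boundaryPassage η m (n + 1) : ℕ) : ℝ) ≤
        ((∑ i ∈ Finset.range z, η (i + 1, 0) : ℕ) : ℝ) + passage (shift (z + 1) 1 η) k n := by
      exact_mod_cast hz
    rcases le_total d z with hd | hd
    · have := farH z (by omega) hd
      rw [show m - z = k by omega] at h2 this
      linarith
    · have hmono : (passage (shift (z + 1) 1 η) k n : ℝ) ≤ passage (shift 1 1 η) m n := by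
        rw [← hzk]; exact_mod_cast passage_shift_horizontal_le η z k n
      linarith [nearH z hd]
  · obtain ⟨h1, h2⟩ := hV z (by omega)
    have hz2 : ((boundaryPassage η m (n + 1) : ℕ) : ℝ) ≤
        ((∑ j ∈ Finset.range (z + 1), η (0, j + 1) : ℕ) : ℝ) +
          passage (shift 1 (z + 1) η) m k := by
      exact_mod_cast hz
    rcases le_total d z with hd | hd
    · have := farV z (by omega) hd
      rw [show n - z = k by omega] at h2 this
      linarith
    · have hmono : (passage (shift 1 (z + 1) η) m k : ℝ) ≤ passage (shift 1 1 η) m n := by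
        rw [← hzk]; exact_mod_cast passage_shift_vertical_le η z k m
      linarith [nearV z hd]

/-- The probabilistic part of the exit point argument: every term of the exit decomposition
concentrates, up to exponentially small probabilities. -/
theorem exists_passage_lower_tail_of_exit {p u v w : unitInterval} (hp0 : 0 < (p : ℝ))
    (hpu : (p : ℝ) < u) (hu1 : (u : ℝ) < 1) (hpv : (p : ℝ) < v) (hv1 : (v : ℝ) < 1)
    (hpw : (p : ℝ) < w) (hw1 : (w : ℝ) < 1) {δ R : ℝ} (hδ : 0 < δ) (hR : 0 < R) :
    ∃ c > 0, ∀ N m n : ℕ, (m : ℝ) ≤ R * N → (n : ℝ) + 1 ≤ R * N → ∀ d x : ℝ,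
      (∀ z ≤ m, d ≤ z → z * (u : ℝ) + (m - z : ℕ) * (v : ℝ) + (n + 1) * meanQueue p v +
        3 * (δ * N) ≤ m * u + (n + 1) * meanQueue p u) →
      (∀ z ≤ n, d ≤ z → (z + 1 : ℕ) * meanQueue p u + m * (w : ℝ) +
        ((n - z : ℕ) + 1) * meanQueue p w + 3 * (δ * N) ≤ m * u + (n + 1) * meanQueue p u) →
      (∀ z : ℕ, z ≤ d → z * (u : ℝ) + 2 * (δ * N) + x ≤ m * u + (n + 1) * meanQueue p u) →
      (∀ z : ℕ, z ≤ d → (z + 1 : ℕ) * meanQueue p u + 2 * (δ * N) + x ≤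
        m * u + (n + 1) * meanQueue p u) →
      (bulkLaw p).real {ξ | (passage ξ m n : ℝ) ≤ x} ≤
        (3 * (m + n) + 8) * Real.exp (-(c * N)) := by
  obtain ⟨c₀, hc₀, h₀⟩ := exists_boundaryPassage_tail hp0 hpu hu1 hδ hR
  obtain ⟨c₁, hc₁, h₁⟩ := exists_horizontal_tail p u hδ hR
  obtain ⟨c₂, hc₂, h₂⟩ := exists_vertical_tail hp0 hpu hu1 hδ hR
  obtain ⟨c₃, hc₃, h₃⟩ := exists_passage_upper_tail hp0 hpv hv1 hδ hR
  obtain ⟨c₄, hc₄, h₄⟩ := exists_passage_upper_tail hp0 hpw hw1 hδ hR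
  obtain ⟨c, hc0, l₀, l₁, l₂, l₃, l₄⟩ :
      ∃ c > 0, c ≤ c₀ ∧ c ≤ c₁ ∧ c ≤ c₂ ∧ c ≤ c₃ ∧ c ≤ c₄ :=
    ⟨min c₀ (min (min c₁ c₂) (min c₃ c₄)), by positivity, by simp, by simp, by simp, by simp,
      by simp⟩
  have hexp {c' : ℝ} (h : c ≤ c') (N : ℕ) : Real.exp (-(c' * N)) ≤ Real.exp (-(c * N)) :=
    Real.exp_le_exp.2 (neg_le_neg (mul_le_mul_of_nonneg_right h N.cast_nonneg))
  refine ⟨c, hc0, fun N m n hmR hnR d x farH farV nearH nearV => ?_⟩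
  have hmeas (a b : ℕ) : Measurable fun ξ => (passage ξ a b : ℝ) :=
    (measurable_of_countable (fun k : ℕ => (k : ℝ))).comp (measurable_passage a b)
  set μ := Measure.infinitePi (boundaryLaw p u) with hμ
  set E : Set (ℕ × ℕ → ℕ) := {η | (boundaryPassage η m (n + 1) : ℝ) ≤
    m * u + ((n + 1 : ℕ) : ℝ) * meanQueue p u - δ * N} with hE_def
  set H : ℕ → Set (ℕ × ℕ → ℕ) := fun z =>
    {η | z * (u : ℝ) + δ * N ≤ ((∑ i ∈ Finset.range z, η (i + 1, 0) : ℕ) : ℝ)} ∪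
    shift (z + 1) 1 ⁻¹' {ξ | ((m - z : ℕ) : ℝ) * (v : ℝ) + (n + 1) * meanQueue p v + δ * N ≤
      (passage ξ (m - z) n : ℝ)} with hH_def
  set V : ℕ → Set (ℕ × ℕ → ℕ) := fun z =>
    {η | ((z + 1 : ℕ) : ℝ) * meanQueue p u + δ * N ≤
      ((∑ j ∈ Finset.range (z + 1), η (0, j + 1) : ℕ) : ℝ)} ∪
    shift 1 (z + 1) ⁻¹' {ξ | m * (w : ℝ) + (((n - z : ℕ) : ℝ) + 1) * meanQueue p w + δ * N ≤
      (passage ξ m (n - z) : ℝ)} with hV_def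
  have hE : μ.real E ≤ 2 * Real.exp (-(c * N)) :=
    (h₀ N m (n + 1) hmR (by push_cast; exact hnR)).2.trans
      (mul_le_mul_of_nonneg_left (hexp l₀ N) zero_le_two)
  have hH : ∀ z ∈ Finset.range (m + 1), μ.real (H z) ≤ 3 * Real.exp (-(c * N)) := by
    intro z hz
    have hz' : z ≤ m := by simpa [Nat.lt_succ_iff] using hz
    refine (measureReal_union_le _ _).trans ?_
    rw [(measurePreserving_shift_boundaryLaw p u z 0).measureReal_preimage
      (measurableSet_le measurable_const (hmeas _ _)).nullMeasurableSet]
    have a1 := (h₁ N z (le_trans (by exact_mod_cast hz') hmR)).1.trans (hexp l₁ N)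
    have a2 := (h₃ N (m - z) n (le_trans (by exact_mod_cast Nat.sub_le m z) hmR) hnR).trans
      (mul_le_mul_of_nonneg_left (hexp l₃ N) zero_le_two)
    linarith
  have hV : ∀ z ∈ Finset.range (n + 1), μ.real (V z) ≤ 3 * Real.exp (-(c * N)) := by
    intro z hz
    have hz' : z + 1 ≤ n + 1 := by simpa [Nat.lt_succ_iff] using hz
    refine (measureReal_union_le _ _).trans ?_
    rw [(measurePreserving_shift_boundaryLaw p u 0 z).measureReal_preimage
      (measurableSet_le measurable_const (hmeas _ _)).nullMeasurableSet]
    have a1 := (h₂ N (z + 1) (le_trans (by exact_mod_cast hz') hnR)).1.trans (hexp l₂ N)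
    have hnz : ((n - z : ℕ) : ℝ) + 1 ≤ n + 1 := by exact_mod_cast Nat.succ_le_succ (Nat.sub_le n z)
    have a2 := (h₄ N m (n - z) hmR (hnz.trans hnR)).trans
      (mul_le_mul_of_nonneg_left (hexp l₄ N) zero_le_two)
    linarith
  rw [← (measurePreserving_shift_boundaryLaw p u 0 0).measureReal_preimage
    (measurableSet_le (hmeas _ _) measurable_const).nullMeasurableSet]
  have hsub : shift (0 + 1) (0 + 1) ⁻¹' {ξ | (passage ξ m n : ℝ) ≤ x} ⊆
      E ∪ ((⋃ z ∈ Finset.range (m + 1), H z) ∪ ⋃ z ∈ Finset.range (n + 1), V z) := by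
    intro η hη
    by_contra hcon
    simp only [mem_union, mem_iUnion, not_or, not_exists] at hcon
    obtain ⟨hnE, hnH, hnV⟩ := hcon
    refine absurd (lt_passage_of_exit (e := δ * N) ?_ (fun z hz => ?_) (fun z hz => ?_)
      farH farV nearH nearV) (not_lt.2 hη)
    · rw [hE_def, mem_ofPred_eq, not_le] at hnE
      push_cast at hnE
      exact hnE
    · have := hnH z (by simp; omega)
      simpa only [hH_def, mem_union, mem_ofPred_eq, mem_preimage, not_or, not_le] using this
    · have := hnV z (by simp; omega)
      simpa only [hV_def, mem_union, mem_ofPred_eq, mem_preimage, not_or, not_le] using this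
  have hbi (k : ℕ) (F : ℕ → Set (ℕ × ℕ → ℕ))
      (hF : ∀ z ∈ Finset.range (k + 1), μ.real (F z) ≤ 3 * Real.exp (-(c * N))) :
      μ.real (⋃ z ∈ Finset.range (k + 1), F z) ≤ (k + 1) * (3 * Real.exp (-(c * N))) := by
    refine (measureReal_biUnion_finset_le _ _).trans ((Finset.sum_le_sum hF).trans_eq ?_)
    simp
  refine (measureReal_mono hsub).trans ((measureReal_union_le _ _).trans ?_)
  have h5 := measureReal_union_le (μ := μ) (⋃ z ∈ Finset.range (m + 1), H z)
    (⋃ z ∈ Finset.range (n + 1), V z)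
  linarith [hbi m H hH, hbi n V hV]

/-- The last passage time is at least `N (shape - κ)` with probability tending to one: the
stationary last passage time has mean about `N * shape`, and its optimal path leaves the axes close
to the origin. -/
theorem tendsto_passage_lower_tail (p : unitInterval) (hp0 : 0 < (p : ℝ)) (hp1 : (p : ℝ) < 1)
    {s t κ : ℝ} (hs : 0 < s) (ht : 0 < t) (hst : t < s * ((1 - p) / p)) (hκ : 0 < κ) :
    Tendsto (fun N : ℕ => (bulkLaw p).real
      {ξ | (passage ξ ⌊(N : ℝ) * s⌋₊ ⌊(N : ℝ) * t⌋₊ : ℝ) ≤ N * (shape p s t - κ)}) atTop (𝓝 0) := by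
  obtain ⟨x, hx0, hx1, hx, hγ⟩ := exists_optimal_parameter hp0 hp1 hs ht hst
  set β := meanQueue p (p + x) with hβ
  have hβ0 : 0 ≤ β := by
    rw [hβ, meanQueue, add_sub_cancel_left]
    exact div_nonneg (mul_nonneg hp0.le (by linarith)) hx0.le
  set ε := κ / (4 * (1 + β)) with hε
  have hε0 : 0 < ε := by positivity
  have hεκ : ε * (1 + β) = κ / 4 := by rw [hε]; field_simp
  have hεβ : 0 ≤ ε * β := by positivity
  obtain ⟨u₁, hu₁, hu₁', hβ₁, hg₁⟩ := exists_horizontal_gap hp0 hs hx0 hx1 hx hε0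
  obtain ⟨u₂, hu₂, hu₂', hβ₂, hg₂⟩ := exists_vertical_gap hp0 hs hx0 hx1 hx hε0
  rw [← hβ] at hβ₁ hg₁ hβ₂ hg₂
  set g₁ := (s - ε) * (p + x - u₁) + t * (β - meanQueue p u₁) with hg₁_def
  set g₂ := s * (p + x - u₂) + (t - ε) * (β - meanQueue p u₂) with hg₂_def
  obtain ⟨δ, hδ0, hδκ, hδ₁, hδ₂⟩ : ∃ δ > 0, δ ≤ κ / 8 ∧ δ ≤ g₁ / 3 ∧ δ ≤ g₂ / 6 :=
    ⟨min (κ / 8) (min (g₁ / 3) (g₂ / 6)), by positivity, by simp, by simp, by simp⟩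
  set R := s + t + 1 with hR
  have hR0 : 0 < R := by positivity
  -- the three parameters as points of the unit interval
  obtain ⟨u, hu⟩ : ∃ u : unitInterval, (u : ℝ) = p + x := ⟨⟨p + x, by linarith, by linarith⟩, rfl⟩
  obtain ⟨v, hv⟩ : ∃ v : unitInterval, (v : ℝ) = u₁ := ⟨⟨u₁, by linarith, by linarith⟩, rfl⟩
  obtain ⟨w, hw⟩ : ∃ w : unitInterval, (w : ℝ) = u₂ := ⟨⟨u₂, by linarith, by linarith⟩, rfl⟩
  obtain ⟨c, hc0, hbound⟩ := exists_passage_lower_tail_of_exit (u := u) (v := v) (w := w) hp0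
    (by linarith) (by linarith) (by linarith) (by linarith) (by linarith) (by linarith) hδ0 hR0
  rw [hu, hv, hw, ← hβ] at hbound
  refine squeeze_zero' (Eventually.of_forall fun N => measureReal_nonneg) ?_
    (tendsto_affine_mul_exp_neg (3 * R + 8) hc0)
  have hN₂ : ∀ᶠ N : ℕ in atTop, 2 * (1 + β) / κ < N :=
    tendsto_natCast_atTop_atTop.eventually_gt_atTop _
  have hN₃ : ∀ᶠ N : ℕ in atTop, 2 * (1 + meanQueue p u₂) / g₂ < N :=
    tendsto_natCast_atTop_atTop.eventually_gt_atTop _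
  filter_upwards [eventually_ge_atTop 1, hN₂, hN₃] with N hN1 hN2 hN3
  rw [div_lt_iff₀ hκ] at hN2
  rw [div_lt_iff₀ hg₂] at hN3
  have hN1' : (1 : ℝ) ≤ N := by exact_mod_cast hN1
  have hN0 : (0 : ℝ) ≤ N := N.cast_nonneg
  set m := ⌊(N : ℝ) * s⌋₊ with hm
  set n := ⌊(N : ℝ) * t⌋₊ with hn
  have hm1 : (m : ℝ) ≤ N * s := Nat.floor_le (by positivity)
  have hm2 : (N : ℝ) * s < m + 1 := Nat.lt_floor_add_one _
  have hn1 : (n : ℝ) ≤ N * t := Nat.floor_le (by positivity)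
  have hn2 : (N : ℝ) * t < n + 1 := Nat.lt_floor_add_one _
  have hRN : R * N = N * s + N * t + N := by rw [hR]; ring
  have hs0 : 0 ≤ (N : ℝ) * s := by positivity
  have ht0 : 0 ≤ (N : ℝ) * t := by positivity
  have hmR : (m : ℝ) ≤ R * N := by linarith
  have hnR : (n : ℝ) + 1 ≤ R * N := by linarith
  have hmn : (m : ℝ) + n ≤ R * N := by linarith
  -- the stationary last passage time has mean about `N * shape`
  have hmean : (N : ℝ) * shape p s t - 1 ≤ m * (p + x) + (n + 1) * β := by
    have h1 : (N * s - 1) * (p + x) ≤ m * (p + x) :=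
      mul_le_mul_of_nonneg_right (by linarith) (by linarith)
    have h2 : N * t * β ≤ (n + 1) * β := mul_le_mul_of_nonneg_right hn2.le hβ0
    have h3 : (N : ℝ) * shape p s t = N * s * (p + x) + N * t * β := by rw [hγ]; ring
    linarith
  have eκ : δ * N ≤ κ / 8 * N := mul_le_mul_of_nonneg_right hδκ hN0
  have e₁ : δ * N ≤ g₁ / 3 * N := mul_le_mul_of_nonneg_right hδ₁ hN0
  have e₂ : δ * N ≤ g₂ / 6 * N := mul_le_mul_of_nonneg_right hδ₂ hN0
  refine (hbound N m n hmR hnR (ε * N) (N * (shape p s t - κ)) (fun z hz hd => ?_)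
    (fun z hz hd => ?_) (fun z hd => ?_) (fun z hd => ?_)).trans ?_
  · rw [Nat.cast_sub hz]
    have h1 : (N * s - ε * N) * (p + x - u₁) ≤ (m - z) * (p + x - u₁) :=
      mul_le_mul_of_nonpos_right (by linarith) (by linarith)
    have h2 : N * t * (β - meanQueue p u₁) ≤ (n + 1) * (β - meanQueue p u₁) :=
      mul_le_mul_of_nonneg_right hn2.le (by linarith)
    have h3 : g₁ * N = (N * s - ε * N) * (p + x - u₁) + N * t * (β - meanQueue p u₁) := by
      rw [hg₁_def]; ring
    linarith
  · rw [Nat.cast_sub hz]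
    push_cast
    have h1 : (N * t - ε * N) * (β - meanQueue p u₂) ≤ (n - z) * (β - meanQueue p u₂) :=
      mul_le_mul_of_nonpos_right (by linarith) (by linarith)
    have h2 : (N * s - 1) * (p + x - u₂) ≤ m * (p + x - u₂) :=
      mul_le_mul_of_nonneg_right (by linarith) (by linarith)
    have h3 : g₂ * N = N * s * (p + x - u₂) + (N * t - ε * N) * (β - meanQueue p u₂) := by
      rw [hg₂_def]; ring
    linarith
  · have h1 : (z : ℝ) * (p + x) ≤ z := mul_le_of_le_one_right z.cast_nonneg (by linarith)
    have h2 : ε * N ≤ κ / 4 * N := mul_le_mul_of_nonneg_right (by linarith) hN0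
    linarith
  · push_cast
    have h1 : (z : ℝ) * β ≤ ε * N * β := mul_le_mul_of_nonneg_right hd hβ0
    have h2 : ε * β * N ≤ κ / 4 * N := mul_le_mul_of_nonneg_right (by linarith) hN0
    linarith
  · exact mul_le_mul_of_nonneg_right (by linarith) (Real.exp_pos _).le

/-! ### Independence of disjoint blocks -/

/-- Functions of the bulk environment that depend on disjoint finite sets of sites are
independent. -/
theorem iIndepFun_of_disjoint {κ : Type*} (p : unitInterval) (S : κ → Finset (ℕ × ℕ))
    (hS : Pairwise fun i j => Disjoint (S i) (S j)) (F : κ → (ℕ × ℕ → ℕ) → ℕ)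
    (hF : ∀ k, Measurable (F k))
    (hdep : ∀ k ξ ξ', (∀ v ∈ S k, ξ v = ξ' v) → F k ξ = F k ξ') :
    iIndepFun F (bulkLaw p) := by
  classical
  -- split the environment into its restrictions to the sets `S k`
  let φ : (ℕ × ℕ → ℕ) → (k : κ) → S k → ℕ := fun ξ k v => ξ v
  have hφ : Measurable φ := measurable_pi_iff.2 fun k => measurable_pi_iff.2 fun v =>
    measurable_pi_apply _
  let ν : (k : κ) → Measure (S k → ℕ) := fun k => Measure.infinitePi fun _ : S k => berLaw p
  have hmap : (bulkLaw p).map φ = Measure.infinitePi ν := by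
    have h1 := Measure.map_infinitePi_infinitePi_of_inj (P := fun _ : ℕ × ℕ => berLaw p)
      (f := fun x : (k : κ) × S k => (x.2 : ℕ × ℕ)) (by
        rintro ⟨k, v⟩ ⟨k', v'⟩ h
        simp only at h
        by_cases hk : k = k'
        · subst hk; simp [Subtype.ext h]
        · exact absurd (h ▸ v'.2) (Finset.disjoint_left.1 (hS hk) v.2))
    have h2 := Measure.infinitePi_map_piCurry (X := fun (k : κ) (_ : S k) => ℕ)
      (fun k (_ : S k) => berLaw p)
    rw [← h1] at h2
    have hr : Measurable fun (ξ : ℕ × ℕ → ℕ) (x : (k : κ) × S k) => ξ (x.2 : ℕ × ℕ) :=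
      measurable_pi_iff.2 fun _ => measurable_pi_apply _
    exact (Measure.map_map (MeasurableEquiv.measurable (MeasurableEquiv.piCurry
      fun (k : κ) (_ : S k) => ℕ)) hr).symm.trans h2
  let ext : (k : κ) → (S k → ℕ) → ℕ × ℕ → ℕ := fun k y v => if h : v ∈ S k then y ⟨v, h⟩ else 0
  have hext (k : κ) : Measurable (ext k) := by
    refine measurable_pi_iff.2 fun v => ?_
    by_cases h : v ∈ S k
    · simp only [ext, h, dif_pos]; exact measurable_pi_apply _
    · simp only [ext, h]; exact measurable_const
  have hFext (k : κ) (ξ : ℕ × ℕ → ℕ) : F k (ext k (φ ξ k)) = F k ξ :=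
    hdep k _ _ fun v hv => by simp [ext, φ, hv]
  have hX (k : κ) : Measurable fun y : (k : κ) → S k → ℕ => F k (ext k (y k)) :=
    ((hF k).comp (hext k)).comp (measurable_pi_apply k)
  have hind := iIndepFun_infinitePi (P := ν) (X := fun k y => F k (ext k y))
    fun k => (hF k).comp (hext k)
  rw [iIndepFun_iff_map_fun_eq_infinitePi_map hX, ← hmap,
    Measure.map_map (measurable_pi_iff.2 hX) hφ] at hind
  rw [iIndepFun_iff_map_fun_eq_infinitePi_map hF]
  convert! hind using 2
  · funext ξ k
    exact (hFext k ξ).symm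
  · funext k
    rw [Measure.map_map (hX k) hφ]
    congr 1
    funext ξ
    exact (hFext k ξ).symm

theorem measurable_shift (a b : ℕ) : Measurable (shift a b) :=
  measurable_pi_iff.2 fun _ => measurable_pi_apply _

/-- The sites that the last passage time from `(a, b)` to `(a + m, b + n)` depends on. -/
def block (a b m n : ℕ) : Finset (ℕ × ℕ) := Finset.Ico a (a + m) ×ˢ Finset.Icc b (b + n)

theorem passage_shift_congr {a b m n : ℕ} {ξ ξ' : ℕ × ℕ → ℕ}
    (h : ∀ v ∈ block a b m n, ξ v = ξ' v) :
    passage (shift a b ξ) m n = passage (shift a b ξ') m n :=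
  passage_congr fun i hi j hj => h _ (by simp [block]; omega)

/-- Supermultiplicativity of the right tail. -/
theorem measure_mul_le_of_superadditive (p : unitInterval) (m n k l : ℕ) (x y : ℝ) :
    (bulkLaw p).real {ξ | x ≤ passage ξ m n} * (bulkLaw p).real {ξ | y ≤ passage ξ k l} ≤
      (bulkLaw p).real {ξ | x + y ≤ passage ξ (m + k) (n + l)} := by
  have hind : IndepFun (fun ξ => passage (shift 0 0 ξ) m n) (fun ξ => passage (shift m n ξ) k l)
      (bulkLaw p) := by
    have h := iIndepFun_of_disjoint p
      (fun b : Bool => cond b (block 0 0 m n) (block m n k l)) (by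
        have key : Disjoint (block 0 0 m n) (block m n k l) := by
          rw [Finset.disjoint_left]
          intro v hv hv'
          simp only [block, Finset.mem_product, Finset.mem_Ico] at hv hv'
          omega
        rintro (_ | _) (_ | _) h
        · exact absurd rfl h
        · exact key.symm
        · exact key
        · exact absurd rfl h)
      (fun b => cond b (fun ξ => passage (shift 0 0 ξ) m n) fun ξ => passage (shift m n ξ) k l)
      (by rintro (_ | _)
          · exact (measurable_passage k l).comp (measurable_shift m n)
          · exact (measurable_passage m n).comp (measurable_shift 0 0))
      (by rintro (_ | _) ξ ξ' h <;> exact passage_shift_congr h)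
    exact h.indepFun (show true ≠ false by simp)
  have h1 := hind.measure_inter_preimage_eq_mul {i : ℕ | x ≤ i} {i : ℕ | y ≤ i} .of_discrete
    .of_discrete
  have h2 : (bulkLaw p).real {ξ | y ≤ passage ξ k l} =
      (bulkLaw p).real ((fun ξ => passage (shift m n ξ) k l) ⁻¹' {i : ℕ | y ≤ i}) :=
    ((measurePreserving_shift_bulkLaw p m n).measureReal_preimage
      ((measurable_passage k l (MeasurableSet.of_discrete (s := {i : ℕ | y ≤ i})))
        ).nullMeasurableSet).symm
  rw [h2, measureReal_def, measureReal_def, ← ENNReal.toReal_mul]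
  have h3 : (fun ξ => passage (shift 0 0 ξ) m n) ⁻¹' {i : ℕ | x ≤ i} =
      {ξ | x ≤ passage ξ m n} := rfl
  rw [h3] at h1
  rw [← h1]
  refine measureReal_mono fun ξ hξ => ?_
  have h4 := passage_add_le ξ m n k l
  have h5 : x ≤ passage ξ m n := hξ.1
  have h6 : y ≤ passage (shift m n ξ) k l := hξ.2
  have h7 : (passage ξ m n : ℝ) + passage (shift m n ξ) k l ≤ passage ξ (m + k) (n + l) := by
    exact_mod_cast h4
  simp only [mem_ofPred_eq]
  linarith

/-! ### The left tail -/

theorem sum_passage_le (ξ : ℕ × ℕ → ℕ) (a m n M : ℕ) :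
    ∑ j ∈ Finset.range M, passage (shift ((a + j) * m) (j * n) ξ) m n ≤
      passage ξ ((a + M) * m) (M * n) := by
  induction M with
  | zero => simp
  | succ M ih =>
    rw [Finset.sum_range_succ, show (a + (M + 1)) * m = (a + M) * m + m by ring,
      show (M + 1) * n = M * n + n by ring]
    exact (Nat.add_le_add_right ih _).trans (passage_add_le ξ _ _ m n)

/-- The blocks of size `m × n`, `n ≥ 1`, at the positions `((2 i + j) m, j n)` are independent:
blocks in the same column are at least two rows of blocks apart. -/
theorem iIndepFun_blocks (p : unitInterval) (m : ℕ) {n : ℕ} (hn : 1 ≤ n) :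
    iIndepFun (fun (q : ℕ × ℕ) ξ => passage (shift ((2 * q.1 + q.2) * m) (q.2 * n) ξ) m n)
      (bulkLaw p) := by
  refine iIndepFun_of_disjoint p (fun q => block ((2 * q.1 + q.2) * m) (q.2 * n) m n) ?_
    (fun (q : ℕ × ℕ) ξ => passage (shift ((2 * q.1 + q.2) * m) (q.2 * n) ξ) m n)
    (fun q => (measurable_passage m n).comp (measurable_shift _ _))
    fun q ξ ξ' h => passage_shift_congr (a := (2 * q.1 + q.2) * m) (b := q.2 * n) h
  rintro ⟨i, j⟩ ⟨i', j'⟩ hne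
  rw [Finset.disjoint_left]
  rintro ⟨a, b⟩ hv hv'
  simp only [block, Finset.mem_product, Finset.mem_Ico, Finset.mem_Icc] at hv hv'
  have column {c c' : ℕ} (h1 : c * m ≤ a) (h2 : a < c' * m + m) : c ≤ c' := by
    by_contra! hc
    have := Nat.mul_le_mul_right m (Nat.succ_le_of_lt hc)
    rw [Nat.succ_mul] at this
    omega
  have row {c c' : ℕ} (h1 : c * n ≤ b) (h2 : b ≤ c' * n + n) : c < c' + 2 := by
    by_contra! hc
    have := Nat.mul_le_mul_right n hc
    rw [add_mul] at this
    omega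
  have hc : 2 * i + j = 2 * i' + j' :=
    le_antisymm (column hv.1.1 hv'.1.2) (column hv'.1.1 hv.1.2)
  have r1 := row hv.2.1 hv'.2.2
  have r2 := row hv'.2.1 hv.2.2
  exact hne (by rw [Prod.mk.injEq]; omega)

/-- If the last passage time is at most `x`, then the sum over each of `L` disjoint strips of `M`
blocks is at most `x`; the total sum is then at most `L x`, which the Chernoff bound makes
unlikely. -/
theorem measureReal_passage_le_of_strips (p : unitInterval) (m : ℕ) {n : ℕ} (hn : 1 ≤ n) {a g : ℝ}
    (ha : 0 ≤ a) (h : ∫⁻ ξ, ENNReal.ofReal (Real.exp (-(a * (passage ξ m n : ℝ)))) ∂(bulkLaw p) ≤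
      ENNReal.ofReal (Real.exp (-g))) (L M : ℕ) (x : ℝ) :
    (bulkLaw p).real {ξ | (passage ξ ((2 * L + M) * m) (M * n) : ℝ) ≤ x} ≤
      Real.exp (L * (a * x) - L * (M * g)) := by
  set B : ℕ × ℕ → (ℕ × ℕ → ℕ) → ℕ := fun q ξ =>
    passage (shift ((2 * q.1 + q.2) * m) (q.2 * n) ξ) m n with hB
  have hBm (q : ℕ × ℕ) : Measurable (B q) := (measurable_passage m n).comp (measurable_shift _ _)
  set S := Finset.range L ×ˢ Finset.range M with hS
  set f : ℕ → ℝ≥0∞ := fun b => ENNReal.ofReal (Real.exp (-(a * (b : ℝ)))) with hf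
  have hfm : Measurable f := measurable_of_countable _
  have hint : ∫⁻ ξ, ENNReal.ofReal (Real.exp (-(a * ∑ q ∈ S, (B q ξ : ℝ)))) ∂(bulkLaw p) ≤
      ENNReal.ofReal (Real.exp (-(L * (M * g)))) := by
    have hmul := lintegral_prod_eq_prod_lintegral_of_indepFun (μ := bulkLaw p) S
      (fun q ξ => f (B q ξ)) ((iIndepFun_blocks p m hn).comp (fun _ => f) fun _ => hfm)
      fun q => hfm.comp (hBm q)
    have hsame (q : ℕ × ℕ) : ∫⁻ ξ, f (B q ξ) ∂(bulkLaw p) ≤ ENNReal.ofReal (Real.exp (-g)) :=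
      ((measurePreserving_shift_bulkLaw p _ _).lintegral_comp
        (hfm.comp (measurable_passage m n))).trans_le h
    calc _ = ∫⁻ ξ, ∏ q ∈ S, f (B q ξ) ∂(bulkLaw p) := by
          refine lintegral_congr fun ξ => ?_
          rw [hf, ← ENNReal.ofReal_prod_of_nonneg fun _ _ => (Real.exp_pos _).le, ← Real.exp_sum,
            Finset.sum_neg_distrib, Finset.mul_sum]
      _ ≤ ∏ _q ∈ S, ENNReal.ofReal (Real.exp (-g)) := by
          rw [hmul]; exact Finset.prod_le_prod' fun q _ => hsame q
      _ = _ := by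
          rw [Finset.prod_const, hS, Finset.card_product, Finset.card_range, Finset.card_range,
            ← ENNReal.ofReal_pow (Real.exp_pos _).le, ← Real.exp_nat_mul]
          congr 2; push_cast; ring
  have hsum (ξ : ℕ × ℕ → ℕ) : ∑ q ∈ S, B q ξ ≤ L * passage ξ ((2 * L + M) * m) (M * n) := by
    have h1 (i : ℕ) (hi : i ∈ Finset.range L) : ∑ j ∈ Finset.range M, B (i, j) ξ ≤
        passage ξ ((2 * L + M) * m) (M * n) := by
      have hi' := Finset.mem_range.1 hi
      exact (sum_passage_le ξ (2 * i) m n M).trans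
        (passage_mono_left ξ _ (Nat.mul_le_mul_right m (by omega)))
    rw [hS, Finset.sum_product]
    simpa using Finset.sum_le_card_nsmul _ _ _ h1
  have hZm : Measurable fun ξ => -(a * ∑ q ∈ S, (B q ξ : ℝ)) :=
    ((Finset.measurable_sum _ fun q _ =>
      (measurable_of_countable (fun k : ℕ => (k : ℝ))).comp (hBm q)).const_mul a).neg
  have hch := measureReal_ge_le_exp (bulkLaw p) hZm hint (-(L * (a * x)))
  refine (measureReal_mono fun ξ hξ => ?_).trans (hch.trans_eq (by congr 1; ring))
  simp only [mem_ofPred_eq] at hξ ⊢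
  have h1 : (∑ q ∈ S, (B q ξ : ℝ)) ≤ L * x :=
    le_trans (by exact_mod_cast hsum ξ) (mul_le_mul_of_nonneg_left hξ L.cast_nonneg)
  have h2 := mul_le_mul_of_nonneg_left h1 ha
  linarith

/-- If the last passage time over a single large block is likely to exceed its typical value, then
the left tail decays faster than the exponential of any multiple of `N`. -/
theorem eventually_left_tail (p : unitInterval) {s t γ κ : ℝ} (hs : 0 < s) (ht : 0 < t)
    (hκ : 0 < κ) (hκγ : κ ≤ γ)
    (h : ∀ κ' > 0, Tendsto (fun N : ℕ => (bulkLaw p).real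
      {ξ | (passage ξ ⌊(N : ℝ) * s⌋₊ ⌊(N : ℝ) * t⌋₊ : ℝ) ≤ N * (γ - κ')}) atTop (𝓝 0)) (C : ℝ) :
    ∀ᶠ N : ℕ in atTop, (bulkLaw p).real
      {ξ | (passage ξ ⌊(N : ℝ) * s⌋₊ ⌊(N : ℝ) * t⌋₊ : ℝ) ≤ N * (γ - κ)} ≤ Real.exp (-(C * N)) := by
  set g := γ - κ / 2 with hg
  have hg0 : 0 ≤ g := by linarith
  have hgap : 0 < Real.exp (-g) - Real.exp (-(γ - κ / 4)) :=
    sub_pos.2 (Real.exp_lt_exp.2 (by linarith))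
  obtain ⟨K, hK, hK1, hKt⟩ := (((h (κ / 4) (by positivity)).eventually_lt_const hgap).and
    ((eventually_ge_atTop 1).and ((tendsto_natCast_atTop_atTop (R := ℝ)).eventually_ge_atTop
      (1 / t)))).exists
  have hK0 : (0 : ℝ) < K := by exact_mod_cast hK1
  set K₁ := ⌊(K : ℝ) * s⌋₊ with hK₁
  set K₂ := ⌊(K : ℝ) * t⌋₊ with hK₂
  have hK₂1 : 1 ≤ K₂ := Nat.le_floor (by
    rw [div_le_iff₀ ht] at hKt; exact_mod_cast hKt)
  have hK₁le : (K₁ : ℝ) ≤ K * s := Nat.floor_le (by positivity)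
  have hK₂le : (K₂ : ℝ) ≤ K * t := Nat.floor_le (by positivity)
  have hblock : ∫⁻ ξ, ENNReal.ofReal (Real.exp (-((K : ℝ)⁻¹ * (passage ξ K₁ K₂ : ℝ))))
      ∂(bulkLaw p) ≤ ENNReal.ofReal (Real.exp (-g)) := by
    set A : Set (ℕ × ℕ → ℕ) := {ξ | (passage ξ K₁ K₂ : ℝ) ≤ K * (γ - κ / 4)} with hA
    have hAm : MeasurableSet A := measurable_passage K₁ K₂
      (MeasurableSet.of_discrete (s := {i : ℕ | (i : ℝ) ≤ K * (γ - κ / 4)}))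
    have h1 (ξ : ℕ × ℕ → ℕ) : ENNReal.ofReal (Real.exp (-((K : ℝ)⁻¹ * (passage ξ K₁ K₂ : ℝ)))) ≤
        A.indicator 1 ξ + ENNReal.ofReal (Real.exp (-(γ - κ / 4))) := by
      by_cases hξ : ξ ∈ A
      · rw [indicator_of_mem hξ]
        refine le_add_right (ENNReal.ofReal_le_one.2 (Real.exp_le_one_iff.2 ?_))
        exact neg_nonpos.2 (by positivity)
      · rw [indicator_of_notMem hξ, zero_add]
        refine ENNReal.ofReal_le_ofReal (Real.exp_le_exp.2 (neg_le_neg ?_))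
        rw [hA, mem_ofPred_eq, not_le] at hξ
        rw [inv_mul_eq_div, le_div_iff₀ hK0]
        linarith
    refine (lintegral_mono h1).trans ?_
    rw [lintegral_add_right _ measurable_const, lintegral_indicator_one hAm, lintegral_const,
      measure_univ, mul_one, ← ofReal_measureReal,
      ← ENNReal.ofReal_add measureReal_nonneg (Real.exp_pos _).le]
    exact ENNReal.ofReal_le_ofReal (by linarith)
  -- the number of strips determines the rate of decay
  obtain ⟨L, hL⟩ := exists_nat_ge ((C + 1) * (2 * K) / κ)
  rw [div_le_iff₀ hκ] at hL
  have hN : ∀ᶠ N : ℕ in atTop, (L : ℝ) * ((1 + 2 * L) * g) ≤ N :=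
    tendsto_natCast_atTop_atTop.eventually_ge_atTop _
  filter_upwards [hN, eventually_ge_atTop (K * (2 * L))] with N hN hNL
  obtain ⟨M, hM⟩ : ∃ M, N / K = 2 * L + M :=
    Nat.exists_eq_add_of_le ((Nat.le_div_iff_mul_le hK1).2 (by rw [mul_comm]; exact hNL))
  have hM1 : ((2 * L + M : ℕ) : ℝ) * K ≤ N := by
    rw [← hM]; exact_mod_cast Nat.div_mul_le_self N K
  have hM2 : (N : ℝ) ≤ (1 + 2 * L + M) * K := by
    have : N < (N / K + 1) * K := by rw [mul_comm]; exact Nat.lt_mul_div_succ N hK1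
    rw [hM] at this
    have h2 : (N : ℝ) < ((2 * L + M + 1 : ℕ) : ℝ) * K := by exact_mod_cast this
    push_cast at h2
    linarith
  have hML : (M : ℝ) ≤ ((2 * L + M : ℕ) : ℝ) := by exact_mod_cast (by omega)
  have hle₁ : (2 * L + M) * K₁ ≤ ⌊(N : ℝ) * s⌋₊ := Nat.le_floor (by
    rw [Nat.cast_mul]
    calc ((2 * L + M : ℕ) : ℝ) * K₁ ≤ ((2 * L + M : ℕ) : ℝ) * (K * s) := by gcongr
      _ = ((2 * L + M : ℕ) : ℝ) * K * s := by ring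
      _ ≤ N * s := by gcongr)
  have hle₂ : M * K₂ ≤ ⌊(N : ℝ) * t⌋₊ := Nat.le_floor (by
    rw [Nat.cast_mul]
    calc (M : ℝ) * K₂ ≤ ((2 * L + M : ℕ) : ℝ) * (K * t) := by gcongr
      _ = ((2 * L + M : ℕ) : ℝ) * K * t := by ring
      _ ≤ N * t := by gcongr)
  refine (measureReal_mono fun ξ hξ => ?_).trans ((measureReal_passage_le_of_strips p K₁ hK₂1
    (inv_nonneg.2 hK0.le) hblock L M (N * (γ - κ))).trans (Real.exp_le_exp.2 ?_))
  · have h1 : passage ξ ((2 * L + M) * K₁) (M * K₂) ≤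
        passage ξ ⌊(N : ℝ) * s⌋₊ ⌊(N : ℝ) * t⌋₊ :=
      (passage_mono_left ξ (M * K₂) hle₁).trans (passage_mono_right ξ _ hle₂)
    exact (Nat.cast_le (α := ℝ).2 h1).trans hξ
  · have h1 : (N : ℝ) / K - (1 + 2 * L) ≤ M := by
      have := (div_le_iff₀ hK0).2 hM2
      linarith
    have h2 : L * (((N : ℝ) / K - (1 + 2 * L)) * g) ≤ L * (M * g) := by gcongr
    have h3 : L * ((K : ℝ)⁻¹ * (N * (γ - κ))) = L * (N / K * g) - L * κ / (2 * K) * N := by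
      rw [hg]; field_simp; ring
    have h4 : (C + 1) * N ≤ L * κ / (2 * K) * N := by
      gcongr
      rw [le_div_iff₀ (by positivity)]
      linarith
    rw [h3]
    linarith

/-! ### Transfer to the given weights -/

theorem map_floor_bernoulliMeasure (p : unitInterval) :
    (bernoulliMeasure (1 : ℝ) 0 p).map (fun x => ⌊x⌋₊) = berLaw p := by
  have hm : Measurable fun x : ℝ => ⌊x⌋₊ := Nat.measurable_floor
  rw [bernoulliMeasure_def, Measure.map_add _ _ hm, Measure.map_smul, Measure.map_smul,
    Measure.map_dirac' hm, Measure.map_dirac' hm]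
  simp [berLaw, bernoulliMeasure_def]

/-- The last passage time of the given weights is almost surely that of an environment with the
law `bulkLaw p`. -/
theorem exists_hasLaw_bulkLaw {Ω : Type*} [MeasurableSpace Ω] {P : Measure Ω}
    {p : unitInterval} {ω : ℕ × ℕ → Ω → ℝ}
    (hlaw : ∀ v, HasLaw (ω v) (bernoulliMeasure (1 : ℝ) 0 p) P) (hindep : iIndepFun ω P) :
    ∃ Ξ : Ω → ℕ × ℕ → ℕ, HasLaw Ξ (bulkLaw p) P ∧
      ∀ᵐ x ∂P, ∀ m n, lastPassage (fun v => ω v x) m n = passage (Ξ x) m n := by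
  have hm : Measurable fun x : ℝ => ⌊x⌋₊ := Nat.measurable_floor
  have hcoord (v : ℕ × ℕ) : HasLaw (fun x => ⌊ω (v.1 + 1, v.2) x⌋₊) (berLaw p) P := by
    refine ⟨hm.comp_aemeasurable (hlaw _).aemeasurable, ?_⟩
    rw [← map_floor_bernoulliMeasure, ← (hlaw (v.1 + 1, v.2)).map_eq,
      AEMeasurable.map_map_of_aemeasurable hm.aemeasurable (hlaw _).aemeasurable]
    rfl
  have hind : iIndepFun (fun (v : ℕ × ℕ) x => ⌊ω (v.1 + 1, v.2) x⌋₊) P :=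
    (hindep.precomp (g := fun v : ℕ × ℕ => (v.1 + 1, v.2)) fun v w h => by
      simp only [Prod.mk.injEq] at h; ext <;> omega).comp (fun _ x => ⌊x⌋₊) fun _ => hm
  refine ⟨fun x v => ⌊ω (v.1 + 1, v.2) x⌋₊, hind.hasLaw_infinitePi hcoord
    (aemeasurable_pi_lambda _ fun v => (hcoord v).aemeasurable), ?_⟩
  have hval : ∀ᵐ x ∂P, ∀ v, ω v x = 1 ∨ ω v x = 0 := ae_all_iff.2 fun v => by
    have hs : MeasurableSet {y : ℝ | y = 1 ∨ y = 0} :=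
      (measurableSet_singleton 1).union (measurableSet_singleton 0)
    refine ((hlaw v).ae_iff (p := fun y => y = 1 ∨ y = 0) (measurableSet_setOfPred.1 hs)).2 ?_
    rw [ae_iff]
    exact bernoulliMeasure_apply_of_notMem_of_notMem _ hs.compl (by simp) (by simp)
  filter_upwards [hval] with x hx m n
  refine lastPassage_eq_passage (fun i j => ?_) m n
  rcases hx (i + 1, j) with h | h <;> simp [h]

/-! ### The estimates behind the large deviation principle -/

/-- The tail estimates for `X N`, `N → ∞`, that imply a large deviation principle with a rate
function that is finite on `[γ, s]`: the right tail is supermultiplicative and decays exponentially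
beyond `γ`, and the left tail decays faster than exponentially. -/
structure TailEstimates {Ω : Type*} [MeasurableSpace Ω] (P : Measure Ω) (X : ℕ → Ω → ℝ)
    (γ s : ℝ) : Prop where
  le : γ ≤ s
  mul_le : ∀ N M x y, P.real {ω | x ≤ X N ω} * P.real {ω | y ≤ X M ω} ≤
    P.real {ω | x + y ≤ X (N + M) ω}
  lower : ∃ c, ∀ (N : ℕ) (x : ℝ), x ≤ ⌊(N : ℝ) * s⌋₊ →
    Real.exp (-(c * N)) ≤ P.real {ω | x ≤ X N ω}
  bounded : ∀ N : ℕ, ∀ᵐ ω ∂P, X N ω ≤ N * s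
  upper : ∀ r, γ < r → r < s → ∃ c > 0, ∀ᶠ N : ℕ in atTop,
    P.real {ω | N * r ≤ X N ω} ≤ Real.exp (-(c * N))
  left : ∀ κ > 0, ∀ C : ℝ, ∀ᶠ N : ℕ in atTop,
    P.real {ω | X N ω ≤ N * (γ - κ)} ≤ Real.exp (-(C * N))

theorem shape_lt {p s t : ℝ} (hp0 : 0 < p) (hp1 : p < 1) (hs : 0 < s) (ht : 0 < t)
    (hst : t < s * ((1 - p) / p)) : 0 < shape p s t ∧ shape p s t < s := by
  obtain ⟨x, hx0, hx1, hx, hγ⟩ := exists_optimal_parameter hp0 hp1 hs ht hst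
  have hq : 0 < 1 - p := by linarith
  have htp : t * p = s * x ^ 2 / (1 - p) := by rw [hx]; field_simp
  have h1 : t * (p * (1 - p) / x) = s * x := by
    rw [← mul_div_assoc, div_eq_iff hx0.ne']; linear_combination -hx
  have h2 : shape p s t = s * p + 2 * (s * x) - s * x ^ 2 / (1 - p) := by
    rw [hγ, meanQueue_add hx0.ne', ← htp]; linear_combination h1
  constructor
  · rw [h2]
    have : s * x ^ 2 / (1 - p) ≤ s * x := by
      rw [div_le_iff₀ hq]; nlinarith [mul_pos hs hx0]
    nlinarith [mul_pos hs hx0, mul_pos hs hp0]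
  · have h3 : s - shape p s t = s / (1 - p) * (1 - p - x) ^ 2 := by
      rw [h2]; field_simp; ring
    have : 0 < s / (1 - p) * (1 - p - x) ^ 2 :=
      mul_pos (by positivity) (pow_pos (by linarith) 2)
    linarith

theorem shape_of_le {p s t : ℝ} (h : s * ((1 - p) / p) ≤ t) : shape p s t = s :=
  if_neg (not_lt.2 h)

/-- The two branches of the shape function match. -/
theorem exists_lt_shape {p s κ : ℝ} (hp0 : 0 < p) (hp1 : p < 1) (hs : 0 < s) (hκ : 0 < κ) :
    ∃ t, 0 < t ∧ t < s * ((1 - p) / p) ∧ s - κ < shape p s t := by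
  have hq : 0 < 1 - p := by linarith
  set t₀ := s * ((1 - p) / p) with ht₀
  have ht₀0 : 0 < t₀ := by positivity
  have hcont : Continuous fun t => (√(p * s) + √((1 - p) * t)) ^ 2 - t := by fun_prop
  have hval : (√(p * s) + √((1 - p) * t₀)) ^ 2 - t₀ = s := by
    have h1 : √(p * s) * √((1 - p) * t₀) = s * (1 - p) := by
      rw [← Real.sqrt_mul (by positivity),
        ← Real.sqrt_sq (show 0 ≤ s * (1 - p) by positivity)]
      congr 1; rw [ht₀]; field_simp
    rw [add_sq, Real.sq_sqrt (by positivity), Real.sq_sqrt (by positivity)]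
    have h2 : p * t₀ = s * (1 - p) := by rw [ht₀]; field_simp
    linear_combination 2 * h1 - h2
  have h1 : ∀ᶠ t in 𝓝[<] t₀, s - κ < (√(p * s) + √((1 - p) * t)) ^ 2 - t :=
    (hcont.tendsto t₀).mono_left nhdsWithin_le_nhds |>.eventually_const_lt (by rw [hval]; linarith)
  have h2 : ∀ᶠ t in 𝓝[<] t₀, 0 < t := nhdsWithin_le_nhds (lt_mem_nhds ht₀0)
  obtain ⟨t, h1, h2, h3⟩ := (h1.and (h2.and self_mem_nhdsWithin)).exists
  exact ⟨t, h2, h3, by rwa [shape, if_pos h3]⟩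

theorem eventually_left_tail_shape (p : unitInterval) (hp0 : 0 < (p : ℝ)) (hp1 : (p : ℝ) < 1)
    {s t κ : ℝ} (hs : 0 < s) (ht : 0 < t) (hκ : 0 < κ) (C : ℝ) :
    ∀ᶠ N : ℕ in atTop, (bulkLaw p).real
      {ξ | (passage ξ ⌊(N : ℝ) * s⌋₊ ⌊(N : ℝ) * t⌋₊ : ℝ) ≤ N * (shape p s t - κ)} ≤
        Real.exp (-(C * N)) := by
  have main {t κ : ℝ} (ht : 0 < t) (hst : t < s * ((1 - p) / p)) (hκ : 0 < κ) :
      ∀ᶠ N : ℕ in atTop, (bulkLaw p).real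
        {ξ | (passage ξ ⌊(N : ℝ) * s⌋₊ ⌊(N : ℝ) * t⌋₊ : ℝ) ≤ N * (shape p s t - κ)} ≤
          Real.exp (-(C * N)) := by
    have hγ := (shape_lt hp0 hp1 hs ht hst).1
    filter_upwards [eventually_left_tail p hs ht (lt_min hκ hγ) (min_le_right _ _)
      (fun κ' hκ' => tendsto_passage_lower_tail p hp0 hp1 hs ht hst hκ') C] with N hN
    refine (measureReal_mono fun ξ hξ => ?_).trans hN
    simp only [mem_ofPred_eq] at hξ ⊢
    exact hξ.trans (by gcongr; exact min_le_left _ _)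
  rcases lt_or_ge t (s * ((1 - p) / p)) with hst | hst
  · exact main ht hst hκ
  -- at and above the critical slope, compare with a slope just below it
  · obtain ⟨t', ht', hst', hsh⟩ := exists_lt_shape hp0 hp1 hs (half_pos hκ)
    filter_upwards [main ht' hst' (half_pos hκ)] with N hN
    refine (measureReal_mono fun ξ hξ => ?_).trans hN
    simp only [mem_ofPred_eq] at hξ ⊢
    rw [shape_of_le hst] at hξ
    have h1 : passage ξ ⌊(N : ℝ) * s⌋₊ ⌊(N : ℝ) * t'⌋₊ ≤ passage ξ ⌊(N : ℝ) * s⌋₊ ⌊(N : ℝ) * t⌋₊ :=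
      passage_mono_right ξ _ (Nat.floor_mono (by gcongr; linarith))
    exact (Nat.cast_le (α := ℝ).2 h1).trans (hξ.trans
      (mul_le_mul_of_nonneg_left (by linarith) N.cast_nonneg))

theorem eventually_upper_tail_shape (p : unitInterval) (hp0 : 0 < (p : ℝ)) (hp1 : (p : ℝ) < 1)
    {s t r : ℝ} (hs : 0 < s) (ht : 0 < t) (hr : shape p s t < r) (hrs : r < s) :
    ∃ c > 0, ∀ᶠ N : ℕ in atTop, (bulkLaw p).real
      {ξ | N * r ≤ (passage ξ ⌊(N : ℝ) * s⌋₊ ⌊(N : ℝ) * t⌋₊ : ℝ)} ≤ Real.exp (-(c * N)) := by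
  have hst : t < s * ((1 - p) / p) := by
    by_contra! h
    rw [shape_of_le h] at hr; linarith
  obtain ⟨x, hx0, hx1, hx, hγ⟩ := exists_optimal_parameter hp0 hp1 hs ht hst
  obtain ⟨u, hu⟩ : ∃ u : unitInterval, (u : ℝ) = p + x := ⟨⟨p + x, by linarith, by linarith⟩, rfl⟩
  have hδ : 0 < (r - shape p s t) / 2 := by linarith
  have hR : 0 < s + t + 1 := by positivity
  obtain ⟨c, hc, h⟩ := exists_passage_upper_tail (u := u) hp0 (by linarith) (by linarith) hδ hR
  set β := meanQueue p u with hβ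
  rw [← hu, ← hβ] at hγ
  have hβ0 : 0 ≤ β := by
    rw [hβ, hu, meanQueue, add_sub_cancel_left]
    exact div_nonneg (mul_nonneg hp0.le (by linarith)) hx0.le
  refine ⟨c / 2, half_pos hc, ?_⟩
  have e1 : ∀ᶠ N : ℕ in atTop, β / ((r - shape p s t) / 2) ≤ N :=
    tendsto_natCast_atTop_atTop.eventually_ge_atTop _
  have e2 : ∀ᶠ N : ℕ in atTop, Real.log 2 / (c / 2) ≤ N :=
    tendsto_natCast_atTop_atTop.eventually_ge_atTop _
  filter_upwards [e1, e2, eventually_ge_atTop 1] with N h1 h2 hN1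
  rw [div_le_iff₀ hδ] at h1
  rw [div_le_iff₀ (half_pos hc)] at h2
  have hN1' : (1 : ℝ) ≤ N := by exact_mod_cast hN1
  have hm : ((⌊(N : ℝ) * s⌋₊ : ℕ) : ℝ) ≤ N * s := Nat.floor_le (by positivity)
  have hn : ((⌊(N : ℝ) * t⌋₊ : ℕ) : ℝ) ≤ N * t := Nat.floor_le (by positivity)
  have hRN : (s + t + 1) * N = N * s + N * t + N := by ring
  have hs0 : 0 ≤ (N : ℝ) * s := by positivity
  have ht0 : 0 ≤ (N : ℝ) * t := by positivity
  have h3 := h N ⌊(N : ℝ) * s⌋₊ ⌊(N : ℝ) * t⌋₊ (by linarith) (by linarith)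
  refine (measureReal_mono fun ξ hξ => ?_).trans (h3.trans ?_)
  · simp only [mem_ofPred_eq] at hξ ⊢
    refine le_trans ?_ hξ
    have a1 : (⌊(N : ℝ) * s⌋₊ : ℝ) * u ≤ N * s * u :=
      mul_le_mul_of_nonneg_right hm u.2.1
    have a2 : ((⌊(N : ℝ) * t⌋₊ : ℝ) + 1) * β ≤ (N * t + 1) * β :=
      mul_le_mul_of_nonneg_right (by linarith) hβ0
    have a3 : (N : ℝ) * shape p s t = N * s * u + N * t * β := by rw [hγ]; ring
    linarith
  · calc 2 * Real.exp (-(c * N)) = Real.exp (Real.log 2 + -(c * N)) := by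
          rw [Real.exp_add, Real.exp_log two_pos]
      _ ≤ _ := Real.exp_le_exp.2 (by linarith)

/-- The path along the horizontal axis bounds the right tail from below. -/
theorem pow_le_passage (p : unitInterval) (m n : ℕ) :
    (p : ℝ) ^ m ≤ (bulkLaw p).real {ξ | m ≤ passage ξ m n} := by
  have h1 : bulkLaw p (((Finset.range m ×ˢ {0} : Finset (ℕ × ℕ)) : Set (ℕ × ℕ)).pi fun _ => {1}) =
      ENNReal.ofReal p ^ m := by
    rw [bulkLaw, Measure.infinitePi_pi _ fun _ _ => measurableSet_singleton 1]
    simp only [berLaw_singleton_one, Finset.prod_const, Finset.card_product, Finset.card_range,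
      Finset.card_singleton, mul_one]
  have h2 : (bulkLaw p).real
      (((Finset.range m ×ˢ {0} : Finset (ℕ × ℕ)) : Set (ℕ × ℕ)).pi fun _ => {1}) = (p : ℝ) ^ m := by
    rw [measureReal_def, h1, ENNReal.toReal_pow, ENNReal.toReal_ofReal p.2.1]
  rw [← h2]
  refine measureReal_mono fun ξ hξ => ?_
  have h3 : passage ξ m 0 = m := by
    rw [passage_zero_right, Finset.sum_congr rfl (g := fun _ => 1) fun i hi => hξ (i, 0)
      (by simpa using hi)]
    simp
  exact h3.symm.le.trans (passage_mono_right ξ m n.zero_le)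

theorem floor_add_le {s : ℝ} (hs : 0 < s) (N M : ℕ) :
    ⌊(N : ℝ) * s⌋₊ + ⌊(M : ℝ) * s⌋₊ ≤ ⌊((N + M : ℕ) : ℝ) * s⌋₊ := by
  refine Nat.le_floor ?_
  push_cast
  have h1 : ((⌊(N : ℝ) * s⌋₊ : ℕ) : ℝ) ≤ N * s := Nat.floor_le (by positivity)
  have h2 : ((⌊(M : ℝ) * s⌋₊ : ℕ) : ℝ) ≤ M * s := Nat.floor_le (by positivity)
  linarith

theorem tailEstimates_G {Ω : Type*} [MeasurableSpace Ω] (P : Measure Ω) [IsProbabilityMeasure P]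
    (p : unitInterval) (hp0 : 0 < (p : ℝ)) (hp1 : (p : ℝ) < 1) (ω : ℕ × ℕ → Ω → ℝ)
    (hlaw : ∀ v, HasLaw (ω v) (bernoulliMeasure (1 : ℝ) 0 p) P) (hindep : iIndepFun ω P)
    (s t : ℝ) (hs : 0 < s) (ht : 0 < t) :
    TailEstimates P (G ω s t) (shape p s t) s := by
  obtain ⟨Ξ, hΞ, hG⟩ := exists_hasLaw_bulkLaw hlaw hindep
  have transfer (N : ℕ) (B : Set ℝ) (hB : MeasurableSet B) : P.real {x | G ω s t N x ∈ B} =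
      (bulkLaw p).real {ξ | (passage ξ ⌊(N : ℝ) * s⌋₊ ⌊(N : ℝ) * t⌋₊ : ℝ) ∈ B} := by
    have hm : MeasurableSet {ξ | (passage ξ ⌊(N : ℝ) * s⌋₊ ⌊(N : ℝ) * t⌋₊ : ℝ) ∈ B} :=
      (measurable_of_countable (fun k : ℕ => (k : ℝ))).comp (measurable_passage _ _) hB
    rw [← hΞ.measureReal_eq hm]
    refine measureReal_congr ?_
    filter_upwards [hG] with x hx
    exact congrArg (· ∈ B) (hx _ _)
  have right (N : ℕ) (y : ℝ) : P.real {x | y ≤ G ω s t N x} =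
      (bulkLaw p).real {ξ | y ≤ (passage ξ ⌊(N : ℝ) * s⌋₊ ⌊(N : ℝ) * t⌋₊ : ℝ)} :=
    transfer N (Ici y) measurableSet_Ici
  have left (N : ℕ) (y : ℝ) : P.real {x | G ω s t N x ≤ y} =
      (bulkLaw p).real {ξ | (passage ξ ⌊(N : ℝ) * s⌋₊ ⌊(N : ℝ) * t⌋₊ : ℝ) ≤ y} :=
    transfer N (Iic y) measurableSet_Iic
  refine ⟨?_, fun N M x y => ?_, ⟨-(s * Real.log p), fun N x hx => ?_⟩, fun N => ?_,
    fun r hr hrs => ?_, fun κ hκ C => ?_⟩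
  · rcases lt_or_ge t (s * ((1 - p) / p)) with h | h
    · exact (shape_lt hp0 hp1 hs ht h).2.le
    · exact (shape_of_le h).le
  · rw [right, right, right]
    refine (measure_mul_le_of_superadditive p _ _ _ _ x y).trans (measureReal_mono fun ξ hξ => ?_)
    have h1 : passage ξ (⌊(N : ℝ) * s⌋₊ + ⌊(M : ℝ) * s⌋₊) (⌊(N : ℝ) * t⌋₊ + ⌊(M : ℝ) * t⌋₊) ≤
        passage ξ ⌊((N + M : ℕ) : ℝ) * s⌋₊ ⌊((N + M : ℕ) : ℝ) * t⌋₊ :=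
      (passage_mono_left ξ (⌊(N : ℝ) * t⌋₊ + ⌊(M : ℝ) * t⌋₊) (floor_add_le hs N M)).trans
      (passage_mono_right ξ _ (floor_add_le ht N M))
    exact le_trans (show x + y ≤ _ from hξ) (Nat.cast_le.2 h1)
  · rw [right]
    have h1 : Real.exp (-(-(s * Real.log p) * N)) ≤ (p : ℝ) ^ ⌊(N : ℝ) * s⌋₊ := by
      rw [← Real.exp_log (pow_pos hp0 _), Real.exp_le_exp, Real.log_pow]
      have h2 : ((⌊(N : ℝ) * s⌋₊ : ℕ) : ℝ) ≤ N * s := Nat.floor_le (by positivity)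
      have h3 := mul_le_mul_of_nonpos_right h2 (Real.log_nonpos hp0.le hp1.le)
      linarith
    refine h1.trans ((pow_le_passage p _ ⌊(N : ℝ) * t⌋₊).trans (measureReal_mono fun ξ hξ => ?_))
    exact hx.trans (Nat.cast_le.2 hξ)
  · have h1 := (hΞ.ae_iff (p := fun ξ => ∀ v, ξ v ≤ 1) (measurableSet_setOfPred.1 (by
      have : {ξ : ℕ × ℕ → ℕ | ∀ v, ξ v ≤ 1} = ⋂ v, (fun ξ => ξ v) ⁻¹' Iic 1 := by ext; simp
      rw [this]
      exact MeasurableSet.iInter fun v => measurable_pi_apply v .of_discrete))).2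
        (ae_bulkLaw_le_one p)
    filter_upwards [hG, h1] with x hx hx1
    rw [G, hx]
    exact le_trans (Nat.cast_le.2 (passage_le hx1 _ _)) (Nat.floor_le (by positivity))
  · simp only [right]
    exact eventually_upper_tail_shape p hp0 hp1 hs ht hr hrs
  · simp only [left]
    exact eventually_left_tail_shape p hp0 hp1 hs ht hκ C

/-! ### The exponential decay rate of a supermultiplicative tail -/

/-- Fekete's lemma for a sequence that is subadditive and of linear growth beyond some index. -/
theorem exists_tendsto_div_of_subadditive {a : ℕ → ℝ} {c : ℝ} {N₀ : ℕ}
    (h0 : ∀ N ≥ N₀, 0 ≤ a N) (hc : ∀ N ≥ N₀, a N ≤ c * N)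
    (hadd : ∀ N ≥ N₀, ∀ M ≥ N₀, a (N + M) ≤ a N + a M) :
    ∃ l, Tendsto (fun N : ℕ => a N / N) atTop (𝓝 l) := by
  set N₁ := max N₀ 1 with hN₁
  set S : Set ℝ := {x | ∃ M ≥ N₁, a M / M = x} with hS
  have hSne : S.Nonempty := ⟨_, N₁, le_rfl, rfl⟩
  have hSbdd : BddBelow S := by
    refine ⟨0, ?_⟩
    rintro x ⟨M, hM, rfl⟩
    exact div_nonneg (h0 M ((le_max_left _ _).trans hM)) M.cast_nonneg
  refine ⟨sInf S, tendsto_order.2 ⟨fun b hb => ?_, fun b hb => ?_⟩⟩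
  · filter_upwards [eventually_ge_atTop N₁] with N hN
    exact hb.trans_le (csInf_le hSbdd ⟨N, hN, rfl⟩)
  · obtain ⟨x, ⟨M, hM, rfl⟩, hx⟩ := exists_lt_of_csInf_lt hSne hb
    have hM0 : N₀ ≤ M := (le_max_left _ _).trans hM
    have hM1 : 1 ≤ M := (le_max_right _ _).trans hM
    have hMpos : (0 : ℝ) < M := by exact_mod_cast hM1
    have hc0 : 0 ≤ c := by
      have := (h0 M hM0).trans (hc M hM0)
      exact nonneg_of_mul_nonneg_left this hMpos
    have hmul (k q : ℕ) (hq : N₀ ≤ q) : a (k * M + q) ≤ k * a M + a q := by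
      induction k with
      | zero => simp
      | succ k ih =>
        rw [show (k + 1) * M + q = M + (k * M + q) by ring]
        have := hadd M hM0 (k * M + q) (hq.trans (Nat.le_add_left _ _))
        push_cast
        linarith
    have hlim : Tendsto (fun N : ℕ => a M / M + c * (2 * M) / N) atTop (𝓝 (a M / M + 0)) :=
      tendsto_const_nhds.add (tendsto_const_div_atTop_nhds_zero_nat _)
    rw [add_zero] at hlim
    filter_upwards [hlim.eventually_lt_const hx, eventually_ge_atTop M] with N hN hNM
    refine lt_of_le_of_lt ?_ hN
    have hNpos : (0 : ℝ) < N := hMpos.trans_le (by exact_mod_cast hNM)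
    obtain ⟨k, q, hNk, hq1, hq2⟩ : ∃ k q, N = k * M + q ∧ M ≤ q ∧ q ≤ 2 * M := by
      obtain ⟨N', rfl⟩ := Nat.exists_eq_add_of_le hNM
      refine ⟨N' / M, M + N' % M, ?_, by omega, ?_⟩
      · have := Nat.div_add_mod' N' M; omega
      · have := Nat.mod_lt N' (show 0 < M by omega); omega
    have h1 := hmul k q (hM0.trans hq1)
    have h2 := hc q (hM0.trans hq1)
    have h3 : c * (q : ℝ) ≤ c * (2 * M) :=
      mul_le_mul_of_nonneg_left (by exact_mod_cast hq2) hc0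
    have h4 : (k : ℝ) * M ≤ N := by
      have : (0 : ℝ) ≤ q := q.cast_nonneg
      rw [hNk]; push_cast; linarith
    have h5 : (k : ℝ) * a M ≤ a M / M * N := by
      calc (k : ℝ) * a M = a M / M * (k * M) := by field_simp
        _ ≤ _ := mul_le_mul_of_nonneg_left h4 (div_nonneg (h0 M hM0) hMpos.le)
    rw [← hNk] at h1
    rw [div_le_iff₀ hNpos, add_mul, div_mul_cancel₀ _ hNpos.ne']
    linarith

/-- A monotone function on `(-∞, s)` that is convex with respect to rational weights is convex. -/
theorem convexOn_Iio_of_monotoneOn {j : ℝ → ℝ} {s : ℝ} (hmono : MonotoneOn j (Iio s))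
    (h : ∀ x < s, ∀ y < s, ∀ k l : ℕ, 0 < k → 0 < l →
      (k + l) * j ((k * x + l * y) / (k + l)) ≤ k * j x + l * j y) : ConvexOn ℝ (Iio s) j := by
  refine LinearOrder.convexOn_of_lt (convex_Iio s) fun x hx y hy hxy a b ha hb hab => ?_
  simp only [smul_eq_mul]
  have hD : 0 ≤ j y - j x := sub_nonneg.2 (hmono hx hy hxy.le)
  by_contra! hcon
  -- a rational weight slightly larger than `b` contradicts `hcon`
  set e := j (a * x + b * y) - (a * j x + b * j y) with he
  have he0 : 0 < e := by linarith
  obtain ⟨q, hq1, hq2⟩ := exists_rat_btwn (show b < min 1 (b + e / (j y - j x + 1)) from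
    lt_min (by linarith) (by linarith [div_pos he0 (show 0 < j y - j x + 1 by linarith)]))
  have hq3 : (q : ℝ) < 1 := hq2.trans_le (min_le_left _ _)
  have hq4 : (q : ℝ) < b + e / (j y - j x + 1) := hq2.trans_le (min_le_right _ _)
  have hq0 : 0 < q := by exact_mod_cast hb.trans hq1
  have hnum : 0 < q.num := Rat.num_pos.2 hq0
  have hlt : q.num < q.den := Rat.num_lt_denom_iff.2 (by exact_mod_cast hq3)
  obtain ⟨l, hl⟩ := Int.eq_ofNat_of_zero_le hnum.le
  obtain ⟨k, hk⟩ : ∃ k : ℕ, q.den = k + l := ⟨q.den - l, by omega⟩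
  have hl0 : 0 < l := by omega
  have hk0 : 0 < k := by omega
  have hkl : (0 : ℝ) < k + l := by positivity
  have hql : (q : ℝ) * (k + l) = l := by
    have h1 : (q : ℝ) = q.num / q.den := Rat.cast_def q
    rw [h1, hl, hk]; push_cast; field_simp
  have h1 := h x hx y hy k l hk0 hl0
  have hpt : ((k : ℝ) * x + l * y) / (k + l) = (1 - q) * x + q * y := by
    rw [div_eq_iff hkl.ne']; linear_combination (x - y) * hql
  rw [hpt] at h1
  have h2 : j ((1 - q) * x + q * y) ≤ j x + q * (j y - j x) := by
    have h3 : (k + l) * j ((1 - q) * x + q * y) ≤ (k + l) * (j x + q * (j y - j x)) := by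
      refine h1.trans_eq ?_
      linear_combination (j x - j y) * hql
    exact le_of_mul_le_mul_left h3 hkl
  have ha' : a = 1 - b := by linarith
  have hz : a * x + b * y ≤ (1 - q) * x + q * y := by
    rw [ha']; nlinarith
  have hzs : (1 - q) * x + q * y < s := by
    simp only [mem_Iio] at hx hy; nlinarith
  have h3 := hmono (show a * x + b * y ∈ Iio s from hz.trans_lt hzs) hzs hz
  have h4 : q * (j y - j x) < b * (j y - j x) + e ∨ j y - j x = 0 := by
    rcases hD.eq_or_lt with h0 | h0
    · exact Or.inr h0.symm
    · left
      have h5 := mul_lt_mul_of_pos_right hq4 h0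
      have h6 : e / (j y - j x + 1) * (j y - j x) ≤ e := by
        rw [div_mul_eq_mul_div, div_le_iff₀ (by linarith)]; nlinarith
      linarith
  rcases h4 with h4 | h4
  · have : e = j (a * x + b * y) - (j x + b * (j y - j x)) := by rw [he, ha']; ring
    linarith
  · rw [h4, mul_zero, add_zero] at h2
    have : e = j (a * x + b * y) - j x := by rw [he, ha']; linear_combination (-b) * h4
    linarith

namespace TailEstimates

variable {Ω : Type*} [MeasurableSpace Ω] {P : Measure Ω} {X : ℕ → Ω → ℝ} {γ s : ℝ}

theorem lower_rate (h : TailEstimates P X γ s) : ∃ c, ∀ r < s, ∃ N₀ : ℕ, ∀ N ≥ N₀,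
    Real.exp (-(c * N)) ≤ P.real {ω | N * r ≤ X N ω} := by
  obtain ⟨c, hc⟩ := h.lower
  refine ⟨c, fun r hr => ?_⟩
  obtain ⟨N₀, hN₀⟩ := exists_nat_ge (1 / (s - r))
  refine ⟨N₀, fun N hN => hc N _ ?_⟩
  have h1 : 1 / (s - r) ≤ N := hN₀.trans (by exact_mod_cast hN)
  rw [div_le_iff₀ (by linarith)] at h1
  have h2 : (N : ℝ) * s < ⌊(N : ℝ) * s⌋₊ + 1 := Nat.lt_floor_add_one _
  linarith

theorem decay_pos {j : ℝ → ℝ} (h : TailEstimates P X γ s)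
    (hj : ∀ r < s, Tendsto (fun N : ℕ => -Real.log (P.real {ω | N * r ≤ X N ω}) / N) atTop
      (𝓝 (j r))) {r : ℝ} (hr : γ < r) (hrs : r < s) : 0 < j r := by
  obtain ⟨c, hc, hN⟩ := h.upper r hr hrs
  obtain ⟨c', hc'⟩ := h.lower_rate
  obtain ⟨N₀, hN₀⟩ := hc' r hrs
  refine hc.trans_le (ge_of_tendsto (hj r hrs) ?_)
  filter_upwards [hN, eventually_gt_atTop 0, eventually_ge_atTop N₀] with N h1 h2 h3
  rw [le_div_iff₀ (by exact_mod_cast h2), le_neg, ← Real.log_exp (-(c * N))]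
  exact Real.log_le_log ((Real.exp_pos _).trans_le (hN₀ N h3)) h1

variable [IsProbabilityMeasure P]

/-- The decay rate of the right tail exists below `s`, and is a bounded function there. -/
theorem exists_decay (h : TailEstimates P X γ s) : ∃ (j : ℝ → ℝ) (c : ℝ), ∀ r < s,
    0 ≤ j r ∧ j r ≤ c ∧
      Tendsto (fun N : ℕ => -Real.log (P.real {ω | N * r ≤ X N ω}) / N) atTop (𝓝 (j r)) := by
  obtain ⟨c, hc⟩ := h.lower_rate
  have key (r : ℝ) : ∃ l, r < s → 0 ≤ l ∧ l ≤ c ∧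
      Tendsto (fun N : ℕ => -Real.log (P.real {ω | N * r ≤ X N ω}) / N) atTop (𝓝 l) := by
    by_cases hr : r < s
    swap
    · exact ⟨0, fun h => absurd h hr⟩
    obtain ⟨N₀, hN₀⟩ := hc r hr
    have hpos (N : ℕ) (hN : N ≥ N₀) : 0 < P.real {ω | N * r ≤ X N ω} :=
      (Real.exp_pos _).trans_le (hN₀ N hN)
    have h0 : ∀ N ≥ N₀, 0 ≤ -Real.log (P.real {ω | N * r ≤ X N ω}) := fun N hN =>
      neg_nonneg.2 (Real.log_nonpos measureReal_nonneg measureReal_le_one)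
    have h1 : ∀ N ≥ N₀, -Real.log (P.real {ω | N * r ≤ X N ω}) ≤ c * N := fun N hN => by
      rw [neg_le, ← Real.log_exp (-(c * N))]
      exact Real.log_le_log (Real.exp_pos _) (hN₀ N hN)
    obtain ⟨l, hl⟩ := exists_tendsto_div_of_subadditive h0 h1 fun N hN M hM => by
      have h2 := h.mul_le N M (N * r) (M * r)
      rw [← add_mul, ← Nat.cast_add] at h2
      have h3 := Real.log_le_log (mul_pos (hpos N hN) (hpos M hM)) h2
      rw [Real.log_mul (hpos N hN).ne' (hpos M hM).ne'] at h3
      linarith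
    refine ⟨l, fun _ => ⟨ge_of_tendsto hl ?_, le_of_tendsto hl ?_, hl⟩⟩
    · filter_upwards [eventually_ge_atTop N₀] with N hN
      exact div_nonneg (h0 N hN) N.cast_nonneg
    · filter_upwards [eventually_ge_atTop N₀, eventually_gt_atTop 0] with N hN hN0
      rw [div_le_iff₀ (by exact_mod_cast hN0)]
      exact h1 N hN
  choose j hj using key
  exact ⟨j, c, hj⟩

section

variable {j : ℝ → ℝ}

theorem decay_mono (h : TailEstimates P X γ s)
    (hj : ∀ r < s, Tendsto (fun N : ℕ => -Real.log (P.real {ω | N * r ≤ X N ω}) / N) atTop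
      (𝓝 (j r))) : MonotoneOn j (Iio s) := by
  intro r hr r' hr' hrr'
  obtain ⟨c, hc⟩ := h.lower_rate
  obtain ⟨N₀, hN₀⟩ := hc r' hr'
  refine le_of_tendsto_of_tendsto (hj r hr) (hj r' hr') ?_
  filter_upwards [eventually_ge_atTop N₀] with N hN
  refine div_le_div_of_nonneg_right (neg_le_neg (Real.log_le_log
    ((Real.exp_pos _).trans_le (hN₀ N hN)) (measureReal_mono fun ω hω => ?_))) N.cast_nonneg
  exact (mul_le_mul_of_nonneg_left hrr' N.cast_nonneg).trans hω

theorem decay_convex (h : TailEstimates P X γ s)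
    (hj : ∀ r < s, Tendsto (fun N : ℕ => -Real.log (P.real {ω | N * r ≤ X N ω}) / N) atTop
      (𝓝 (j r))) : ConvexOn ℝ (Iio s) j := by
  refine convexOn_Iio_of_monotoneOn (h.decay_mono hj) fun x hx y hy k l hk hl => ?_
  have hk' : (0 : ℝ) < k := by exact_mod_cast hk
  have hl' : (0 : ℝ) < l := by exact_mod_cast hl
  set z := (k * x + l * y) / (k + l) with hz
  have hzs : z < s := by rw [hz, div_lt_iff₀ (by positivity)]; nlinarith
  have sub (m : ℕ) (hm : 0 < m) (r : ℝ) (hr : r < s) : Tendsto (fun N : ℕ =>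
      -Real.log (P.real {ω | ((m * N : ℕ) : ℝ) * r ≤ X (m * N) ω}) / N) atTop (𝓝 (m * j r)) := by
    have h1 := ((hj r hr).comp (tendsto_id.const_mul_atTop' hm)).const_mul (m : ℝ)
    refine h1.congr fun N => ?_
    simp only [Function.comp, id]
    have : (m : ℝ) ≠ 0 := by exact_mod_cast hm.ne'
    rw [mul_div_assoc', Nat.cast_mul, mul_div_mul_left _ _ this]
  have hadd := (sub k hk x hx).add (sub l hl y hy)
  have hsum := sub (k + l) (by omega) z hzs
  rw [Nat.cast_add] at hsum
  refine le_of_tendsto_of_tendsto hsum hadd ?_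
  obtain ⟨c, hc⟩ := h.lower_rate
  obtain ⟨N₁, hN₁⟩ := hc x hx
  obtain ⟨N₂, hN₂⟩ := hc y hy
  filter_upwards [eventually_ge_atTop N₁, eventually_ge_atTop N₂] with N h1 h2
  have p1 := (Real.exp_pos _).trans_le (hN₁ (k * N) (h1.trans (Nat.le_mul_of_pos_left N hk)))
  have p2 := (Real.exp_pos _).trans_le (hN₂ (l * N) (h2.trans (Nat.le_mul_of_pos_left N hl)))
  have h3 := h.mul_le (k * N) (l * N) ((k * N : ℕ) * x) ((l * N : ℕ) * y)
  have e1 : ((k * N : ℕ) : ℝ) * x + ((l * N : ℕ) : ℝ) * y = (((k + l) * N : ℕ) : ℝ) * z := by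
    rw [hz]; push_cast; field_simp
  rw [e1, ← add_mul] at h3
  have h4 := Real.log_le_log (mul_pos p1 p2) h3
  rw [Real.log_mul p1.ne' p2.ne'] at h4
  rw [← add_div]
  exact div_le_div_of_nonneg_right (by linarith) N.cast_nonneg

theorem decay_eq_zero (h : TailEstimates P X γ s)
    (hj : ∀ r < s, Tendsto (fun N : ℕ => -Real.log (P.real {ω | N * r ≤ X N ω}) / N) atTop
      (𝓝 (j r))) {r : ℝ} (hr : r < γ) : j r = 0 := by
  refine tendsto_nhds_unique (hj r (hr.trans_le h.le)) ?_
  have hlim : Tendsto (fun N : ℕ => Real.log 2 / N) atTop (𝓝 0) :=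
    tendsto_const_div_atTop_nhds_zero_nat _
  refine squeeze_zero' (Eventually.of_forall fun N => div_nonneg (neg_nonneg.2
    (Real.log_nonpos measureReal_nonneg measureReal_le_one)) N.cast_nonneg) ?_ hlim
  have hN : ∀ᶠ N : ℕ in atTop, Real.log 2 ≤ N :=
    tendsto_natCast_atTop_atTop.eventually_ge_atTop _
  filter_upwards [h.left (γ - r) (by linarith) 1, hN] with N h1 h2
  refine div_le_div_of_nonneg_right ?_ N.cast_nonneg
  rw [show γ - (γ - r) = r by ring, one_mul] at h1
  have h3 : Real.exp (-(N : ℝ)) ≤ 1 / 2 := by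
    rw [Real.exp_neg, one_div]
    exact inv_anti₀ two_pos ((Real.log_le_iff_le_exp two_pos).1 h2)
  have h4 : 1 ≤ P.real {ω | N * r ≤ X N ω} + P.real {ω | X N ω ≤ N * r} := by
    refine le_trans ?_ (measureReal_union_le _ _)
    have : {ω | N * r ≤ X N ω} ∪ {ω | X N ω ≤ N * r} = univ :=
      eq_univ_of_forall fun ω => show _ ∨ _ from le_total ((N : ℝ) * r) (X N ω)
    rw [this, probReal_univ]
  have h5 : 1 / 2 ≤ P.real {ω | N * r ≤ X N ω} := by linarith
  have h6 := Real.log_le_log (by norm_num) h5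
  rw [one_div, Real.log_inv] at h6
  linarith

end

/-- The rate function: the decay rate of the right tail, extended continuously to `s`. -/
theorem exists_rate (h : TailEstimates P X γ s) : ∃ j : ℝ → ℝ,
    (∀ r < s, Tendsto (fun N : ℕ => -Real.log (P.real {ω | N * r ≤ X N ω}) / N) atTop
      (𝓝 (j r))) ∧ Tendsto j (𝓝[<] s) (𝓝 (j s)) ∧ ContinuousOn j (Iic s) ∧
      ConvexOn ℝ (Iic s) j ∧ MonotoneOn j (Iic s) ∧ StrictMonoOn j (Icc γ s) ∧ j γ = 0 := by
  obtain ⟨j₀, c, hj₀⟩ := h.exists_decay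
  have hlim₀ := fun r hr => (hj₀ r hr).2.2
  have hmono₀ := h.decay_mono hlim₀
  have hconv₀ := h.decay_convex hlim₀
  have hcont₀ : ContinuousOn j₀ (Iio s) := hconv₀.continuousOn isOpen_Iio
  have hbdd : BddAbove (j₀ '' Iio s) := ⟨c, by rintro _ ⟨r, hr, rfl⟩; exact (hj₀ r hr).2.1⟩
  have htend₀ : Tendsto j₀ (𝓝[<] s) (𝓝 (sSup (j₀ '' Iio s))) := hmono₀.tendsto_nhdsLT hbdd
  set j : ℝ → ℝ := fun r => if r < s then j₀ r else sSup (j₀ '' Iio s) with hj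
  have hjlt {r : ℝ} (hr : r < s) : j r = j₀ r := if_pos hr
  have hjs : j s = sSup (j₀ '' Iio s) := if_neg (lt_irrefl s)
  have hlim : ∀ r < s, Tendsto (fun N : ℕ => -Real.log (P.real {ω | N * r ≤ X N ω}) / N) atTop
      (𝓝 (j r)) := fun r hr => (hjlt hr).symm ▸ hlim₀ r hr
  have htend : Tendsto j (𝓝[<] s) (𝓝 (j s)) := by
    rw [hjs]
    refine htend₀.congr' ?_
    filter_upwards [self_mem_nhdsWithin] with r hr
    exact (hjlt hr).symm
  have hconv : ConvexOn ℝ (Iio s) j := hconv₀.congr fun r hr => (hjlt hr).symm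
  have hcont : ContinuousOn j (Iio s) := hcont₀.congr fun r hr => hjlt hr
  have hcontIic : ContinuousOn j (Iic s) := by
    intro r hr
    rcases (mem_Iic.1 hr).lt_or_eq with hr | rfl
    · exact ((hcont r hr).continuousAt (Iio_mem_nhds hr)).continuousWithinAt
    · exact continuousWithinAt_Iio_iff_Iic.1 htend
  have hle {r : ℝ} (hr : r < s) : j r ≤ j s := by
    rw [hjlt hr, hjs]; exact le_csSup hbdd ⟨r, hr, rfl⟩
  have hmono : MonotoneOn j (Iic s) := by
    intro r hr r' hr' hrr'
    rcases (mem_Iic.1 hr').lt_or_eq with h1 | rfl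
    · rw [hjlt h1, hjlt (hrr'.trans_lt h1)]
      exact hmono₀ (hrr'.trans_lt h1) h1 hrr'
    · rcases hrr'.lt_or_eq with h2 | rfl
      · exact hle h2
      · exact le_rfl
  have hconvIic : ConvexOn ℝ (Iic s) j := by
    refine LinearOrder.convexOn_of_lt (convex_Iic s) fun x hx y hy hxy a b ha hb hab => ?_
    rcases (mem_Iic.1 hy).lt_or_eq with hy | rfl
    · exact hconv.2 (hxy.trans hy) hy ha.le hb.le hab
    -- approximate the endpoint from the left
    have hzs : a * x + b * y < y := by
      have h1 := mul_lt_mul_of_pos_left hxy ha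
      have h2 : a * y + b * y = y := by rw [← add_mul, hab, one_mul]
      linarith
    have h1 : Tendsto (fun w => j (a * x + b * w)) (𝓝[<] y) (𝓝 (j (a * x + b * y))) := by
      have h2 : ContinuousAt j (a * x + b * y) := (hcont _ hzs).continuousAt (Iio_mem_nhds hzs)
      have h3 : Tendsto (fun w => a * x + b * w) (𝓝[<] y) (𝓝 (a * x + b * y)) :=
        ((continuous_const.add (continuous_const.mul continuous_id)).tendsto y).mono_left
          nhdsWithin_le_nhds
      exact h2.tendsto.comp h3
    refine le_of_tendsto_of_tendsto h1
      (tendsto_const_nhds.add (htend.const_mul b) :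
        Tendsto (fun w => a * j x + b * j w) (𝓝[<] y) (𝓝 (a * j x + b * j y))) ?_
    filter_upwards [self_mem_nhdsWithin] with w hw
    exact hconv.2 (show x ∈ Iio y from hxy) hw ha.le hb.le hab
  have hzero : j γ = 0 := by
    have h1 : Tendsto j (𝓝[<] γ) (𝓝 (j γ)) :=
      (hcontIic γ h.le).mono_left (nhdsWithin_mono γ fun r hr => (mem_Iio.1 hr).le.trans h.le)
    refine tendsto_nhds_unique h1 (tendsto_const_nhds.congr' ?_)
    filter_upwards [self_mem_nhdsWithin] with r hr
    exact (h.decay_eq_zero hlim hr).symm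
  refine ⟨j, hlim, htend, hcontIic, hconvIic, hmono, fun x hx y hy hxy => ?_, hzero⟩
  have hpos : 0 < j y := by
    have hγy : γ < y := hx.1.trans_lt hxy
    obtain ⟨w, hw1, hw2⟩ := exists_between hγy
    exact (h.decay_pos hlim hw1 (hw2.trans_le hy.2)).trans_le
      (hmono (hw2.le.trans hy.2) hy.2 hw2.le)
  -- a convex function that vanishes at `γ` and is positive later on is strictly increasing
  have hγy : 0 < y - γ := by linarith [hx.1]
  have h1 := hconvIic.2 (show γ ∈ Iic s from h.le) (show y ∈ Iic s from hy.2)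
    (show 0 ≤ (y - x) / (y - γ) from div_nonneg (by linarith) hγy.le)
    (show 0 ≤ (x - γ) / (y - γ) from div_nonneg (by linarith [hx.1]) hγy.le)
    (by field_simp; ring)
  simp only [smul_eq_mul, hzero, mul_zero, zero_add] at h1
  have h2 : (y - x) / (y - γ) * γ + (x - γ) / (y - γ) * y = x := by field_simp; ring
  rw [h2] at h1
  refine h1.trans_lt (mul_lt_of_lt_one_left hpos ?_)
  rw [div_lt_one hγy]; linarith

end TailEstimates

/-! ### Scaled logarithms of probabilities -/

section

variable {Ω : Type*} [MeasurableSpace Ω] {P : Measure Ω} [IsProbabilityMeasure P]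

theorem scaledLog_eq {N : ℕ} {A : Set Ω} (hA : 0 < P.real A) :
    scaledLog P N A = ((Real.log (P.real A) / N : ℝ) : EReal) := by
  have hA0 : P A ≠ 0 := fun h => hA.ne' (by simp [measureReal_def, h])
  rw [scaledLog, ENNReal.log_pos_real hA0 (measure_ne_top P A), ← measureReal_def, EReal.coe_div]
  rfl

theorem scaledLog_le {N : ℕ} (hN : 0 < N) {A : Set Ω} {c : ℝ}
    (hA : P.real A ≤ Real.exp (-(c * N))) : scaledLog P N A ≤ ((-c : ℝ) : EReal) := by
  have hN' : (0 : ℝ) < N := by exact_mod_cast hN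
  rcases measureReal_nonneg.eq_or_lt with h | h
  · have h0 : P A = 0 := (measureReal_eq_zero_iff).1 h.symm
    rw [scaledLog, h0, ENNReal.log_zero, EReal.bot_div_of_pos_ne_top (by exact_mod_cast hN)
      (EReal.natCast_ne_top N)]
    exact bot_le
  · rw [scaledLog_eq h, EReal.coe_le_coe_iff, div_le_iff₀ hN', neg_mul]
    exact (Real.log_le_iff_le_exp h).2 hA

theorem le_scaledLog {N : ℕ} (hN : 0 < N) {A : Set Ω} {c : ℝ}
    (hA : Real.exp (-(c * N)) ≤ P.real A) : ((-c : ℝ) : EReal) ≤ scaledLog P N A := by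
  have hN' : (0 : ℝ) < N := by exact_mod_cast hN
  have h := (Real.exp_pos _).trans_le hA
  rw [scaledLog_eq h, EReal.coe_le_coe_iff, le_div_iff₀ hN', neg_mul]
  exact (Real.le_log_iff_exp_le h).2 hA

end

theorem eventually_two_mul_exp_le {a b : ℝ} (hab : a < b) :
    ∀ᶠ N : ℕ in atTop, 2 * Real.exp (-(b * N)) ≤ Real.exp (-(a * N)) := by
  have hN : ∀ᶠ N : ℕ in atTop, Real.log 2 / (b - a) ≤ N :=
    tendsto_natCast_atTop_atTop.eventually_ge_atTop _
  filter_upwards [hN] with N hN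
  rw [div_le_iff₀ (by linarith)] at hN
  nth_rewrite 1 [← Real.exp_log (two_pos (α := ℝ))]
  rw [← Real.exp_add, Real.exp_le_exp]
  linarith

/-! ### The large deviation principle -/

namespace TailEstimates

variable {Ω : Type*} [MeasurableSpace Ω] {P : Measure Ω} {X : ℕ → Ω → ℝ} {γ s : ℝ} {j : ℝ → ℝ}

theorem eventually_exp_le (h : TailEstimates P X γ s)
    (hj : ∀ r < s, Tendsto (fun N : ℕ => -Real.log (P.real {ω | N * r ≤ X N ω}) / N) atTop
      (𝓝 (j r))) {r c : ℝ} (hr : r < s) (hc : j r < c) :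
    ∀ᶠ N : ℕ in atTop, Real.exp (-(c * N)) ≤ P.real {ω | N * r ≤ X N ω} := by
  obtain ⟨c', hc'⟩ := h.lower_rate
  obtain ⟨N₀, hN₀⟩ := hc' r hr
  filter_upwards [(hj r hr).eventually_lt_const hc, eventually_ge_atTop N₀, eventually_gt_atTop 0]
    with N h1 h2 h3
  rw [div_lt_iff₀ (by exact_mod_cast h3)] at h1
  exact (Real.le_log_iff_exp_le ((Real.exp_pos _).trans_le (hN₀ N h2))).1 (by linarith)

theorem eventually_le_exp (h : TailEstimates P X γ s)
    (hj : ∀ r < s, Tendsto (fun N : ℕ => -Real.log (P.real {ω | N * r ≤ X N ω}) / N) atTop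
      (𝓝 (j r))) {r c : ℝ} (hr : r < s) (hc : c < j r) :
    ∀ᶠ N : ℕ in atTop, P.real {ω | N * r ≤ X N ω} ≤ Real.exp (-(c * N)) := by
  obtain ⟨c', hc'⟩ := h.lower_rate
  obtain ⟨N₀, hN₀⟩ := hc' r hr
  filter_upwards [(hj r hr).eventually_const_lt hc, eventually_ge_atTop N₀, eventually_gt_atTop 0]
    with N h1 h2 h3
  rw [lt_div_iff₀ (by exact_mod_cast h3)] at h1
  exact (Real.log_le_iff_le_exp ((Real.exp_pos _).trans_le (hN₀ N h2))).1 (by linarith)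

variable [IsProbabilityMeasure P]

/-- The upper bound of the large deviation principle, in exponential form: a closed set that misses
`γ` is covered, up to a null event, by a left tail, which is negligible, and by the right tail from
a point where the rate still exceeds `c`. -/
theorem eventually_closed_le (h : TailEstimates P X γ s)
    (hj : ∀ r < s, Tendsto (fun N : ℕ => -Real.log (P.real {ω | N * r ≤ X N ω}) / N) atTop
      (𝓝 (j r))) (hcont : ContinuousOn j (Iic s)) (hzero : j γ = 0) {F : Set ℝ} (hF : IsClosed F)
    {c c' : ℝ} (hc : ∀ r ∈ F ∩ Icc γ s, c' ≤ j r) (hcc' : c < c') :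
    ∀ᶠ N : ℕ in atTop, P.real {ω | X N ω / N ∈ F} ≤ Real.exp (-(c * N)) := by
  by_cases hγ : γ ∈ F
  · have hc0 : c < 0 := by
      have := hc γ ⟨hγ, le_rfl, h.le⟩
      linarith
    refine Eventually.of_forall fun N => measureReal_le_one.trans (Real.one_le_exp ?_)
    have : c * N ≤ 0 := mul_nonpos_of_nonpos_of_nonneg hc0.le N.cast_nonneg
    linarith
  obtain ⟨ε, hε, hball⟩ := Metric.isOpen_iff.1 hF.isOpen_compl γ hγ
  obtain ⟨c₁, hc1, hc2⟩ := exists_between hcc'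
  have hleft {N : ℕ} (hN : 0 < N) {x : ℝ} (hx : x / N ∈ F) (hxγ : x / N < γ) :
      x ≤ N * (γ - ε) := by
    have hN' : (0 : ℝ) < N := by exact_mod_cast hN
    rw [← div_le_iff₀' hN']
    by_contra! hlt
    refine hball ?_ hx
    rw [Metric.mem_ball, Real.dist_eq, abs_lt]
    constructor <;> linarith
  have hright {N : ℕ} (hN : 0 < N) {x : ℝ} (hx : x ≤ N * s) : x / N ≤ s := by
    rwa [div_le_iff₀' (by exact_mod_cast hN)]
  by_cases hK : (F ∩ Icc γ s).Nonempty
  · have hKc : IsCompact (F ∩ Icc γ s) := isCompact_Icc.inter_left hF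
    obtain ⟨hb, hbmin⟩ := hKc.isLeast_sInf hK
    set b := sInf (F ∩ Icc γ s)
    have htend : Tendsto j (𝓝[<] b) (𝓝 (j b)) :=
      (hcont b hb.2.2).mono_left (nhdsWithin_mono b fun r hr => (mem_Iio.1 hr).le.trans hb.2.2)
    obtain ⟨r, hr, hrb⟩ :=
      ((htend.eventually_const_lt (hc2.trans_le (hc b hb))).and self_mem_nhdsWithin).exists
    filter_upwards [h.left ε hε c₁, h.eventually_le_exp hj ((mem_Iio.1 hrb).trans_le hb.2.2) hr,
      eventually_two_mul_exp_le hc1, eventually_gt_atTop 0] with N h1 h2 h3 h4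
    have hle : P.real {ω | X N ω / N ∈ F} ≤
        P.real ({ω | X N ω ≤ N * (γ - ε)} ∪ {ω | N * r ≤ X N ω}) := by
      refine ENNReal.toReal_mono (measure_ne_top _ _) (measure_mono_ae ?_)
      filter_upwards [h.bounded N] with ω hω hωF
      rcases lt_or_ge (X N ω / N) γ with hlt | hge
      · exact Or.inl (hleft h4 hωF hlt)
      · right
        have h5 := hbmin ⟨hωF, hge, hright h4 hω⟩
        have h6 := (mem_Iio.1 hrb).le.trans h5
        exact (le_div_iff₀' (by exact_mod_cast h4)).1 h6
    linarith [measureReal_union_le (μ := P) {ω | X N ω ≤ N * (γ - ε)} {ω | N * r ≤ X N ω}]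
  · filter_upwards [h.left ε hε c, eventually_gt_atTop 0] with N h1 h4
    refine le_trans (ENNReal.toReal_mono (measure_ne_top _ _) (measure_mono_ae ?_)) h1
    filter_upwards [h.bounded N] with ω hω hωF
    rcases lt_or_ge (X N ω / N) γ with hlt | hge
    · exact hleft h4 hωF hlt
    · exact absurd ⟨_, hωF, hge, hright h4 hω⟩ hK

/-- The lower bound of the large deviation principle at a point strictly between `γ` and `s`: the
rate is strictly larger to the right of `r`, so the right tail at `r` is carried by a small
neighbourhood of `r`. -/
theorem eventually_le_open_of_mem_Ioo (h : TailEstimates P X γ s)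
    (hj : ∀ r < s, Tendsto (fun N : ℕ => -Real.log (P.real {ω | N * r ≤ X N ω}) / N) atTop
      (𝓝 (j r))) (hstrict : StrictMonoOn j (Icc γ s)) {H : Set ℝ} (hH : IsOpen H) {r c : ℝ}
    (hr : r ∈ H) (hrγ : γ < r) (hrs : r < s) (hc : j r < c) :
    ∀ᶠ N : ℕ in atTop, Real.exp (-(c * N)) ≤ P.real {ω | X N ω / N ∈ H} := by
  obtain ⟨δ, hδ, hball⟩ := Metric.isOpen_iff.1 hH r hr
  obtain ⟨r', hr1, hr2⟩ := exists_between (show r < min s (r + δ) from lt_min hrs (by linarith))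
  have hr's : r' < s := hr2.trans_le (min_le_left _ _)
  have hr'δ : r' < r + δ := hr2.trans_le (min_le_right _ _)
  have hjj : j r < j r' := hstrict ⟨hrγ.le, hrs.le⟩ ⟨(hrγ.trans hr1).le, hr's.le⟩ hr1
  obtain ⟨c₁, hc1, hc2⟩ := exists_between (lt_min hc hjj)
  obtain ⟨c₂, hc3, hc4⟩ := exists_between (hc2.trans_le (min_le_right _ _))
  filter_upwards [h.eventually_exp_le hj hrs hc1, h.eventually_le_exp hj hr's hc4,
    eventually_two_mul_exp_le hc3, eventually_two_mul_exp_le (hc2.trans_le (min_le_left _ _)),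
    eventually_gt_atTop 0] with N h1 h2 h3 h4 h5
  have hN : (0 : ℝ) < N := by exact_mod_cast h5
  have hsub : {ω | N * r ≤ X N ω} ⊆ {ω | X N ω / N ∈ H} ∪ {ω | N * r' ≤ X N ω} := by
    intro ω hω
    rcases le_or_gt (N * r') (X N ω) with hge | hlt
    · exact Or.inr hge
    · refine Or.inl (hball ?_)
      have h6 : r ≤ X N ω / N := (le_div_iff₀' hN).2 hω
      have h7 : X N ω / N < r' := (div_lt_iff₀' hN).2 hlt
      rw [Metric.mem_ball, Real.dist_eq, abs_lt]
      constructor <;> linarith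
  have h6 := (measureReal_mono (μ := P) hsub).trans (measureReal_union_le _ _)
  linarith

/-- The lower bound of the large deviation principle, in exponential form. -/
theorem eventually_le_open (h : TailEstimates P X γ s)
    (hj : ∀ r < s, Tendsto (fun N : ℕ => -Real.log (P.real {ω | N * r ≤ X N ω}) / N) atTop
      (𝓝 (j r))) (hcont : ContinuousOn j (Iic s)) (hmono : MonotoneOn j (Iic s))
    (hstrict : StrictMonoOn j (Icc γ s)) (hzero : j γ = 0) {H : Set ℝ} (hH : IsOpen H) {r c : ℝ}
    (hr : r ∈ H) (hrI : r ∈ Icc γ s) (hc : j r < c) :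
    ∀ᶠ N : ℕ in atTop, Real.exp (-(c * N)) ≤ P.real {ω | X N ω / N ∈ H} := by
  rcases h.le.eq_or_lt with heq | hlt
  · -- here `γ = s` bounds the variables, and only the left tail has to be excluded
    obtain rfl : r = γ := le_antisymm (hrI.2.trans_eq heq.symm) hrI.1
    rw [hzero] at hc
    obtain ⟨δ, hδ, hball⟩ := Metric.isOpen_iff.1 hH r hr
    filter_upwards [h.left (δ / 2) (by linarith) c, eventually_two_mul_exp_le hc,
      eventually_gt_atTop 0] with N h1 h2 h3
    have hN : (0 : ℝ) < N := by exact_mod_cast h3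
    have h4 : P.real univ ≤
        P.real ({ω | X N ω ≤ N * (r - δ / 2)} ∪ {ω | X N ω / N ∈ H}) := by
      refine ENNReal.toReal_mono (measure_ne_top _ _) (measure_mono_ae ?_)
      filter_upwards [h.bounded N] with ω hω _
      rcases le_or_gt (X N ω) (N * (r - δ / 2)) with hle | hlt
      · exact Or.inl hle
      · refine Or.inr (hball ?_)
        have h6 : r - δ / 2 < X N ω / N := (lt_div_iff₀' hN).2 hlt
        have h7 : X N ω / N ≤ s := (div_le_iff₀' hN).2 hω
        rw [Metric.mem_ball, Real.dist_eq, abs_lt]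
        constructor <;> linarith
    have h5 := h4.trans (measureReal_union_le _ _)
    rw [probReal_univ] at h5
    rw [zero_mul, neg_zero, Real.exp_zero] at h2
    linarith
  · obtain ⟨r', hr'H, hr'γ, hr's, hr'c⟩ : ∃ r' ∈ H, γ < r' ∧ r' < s ∧ j r' < c := by
      rcases hrI.2.eq_or_lt with rfl | hrs
      · -- approach the endpoint from the left
        have h1 : ∀ᶠ r' in 𝓝[<] r, r' ∈ H := nhdsWithin_le_nhds (hH.mem_nhds hr)
        have h2 : ∀ᶠ r' in 𝓝[<] r, γ < r' := nhdsWithin_le_nhds (Ioi_mem_nhds hlt)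
        obtain ⟨r', ⟨h1, h2⟩, h3⟩ := ((h1.and h2).and self_mem_nhdsWithin).exists
        have h4 : r' ≤ r := (mem_Iio.1 h3).le
        exact ⟨r', h1, h2, h3, (hmono h4 self_mem_Iic h4).trans_lt hc⟩
      · -- approach `r`, which may be equal to `γ`, from the right
        have h0 : Tendsto j (𝓝[>] r) (𝓝 (j r)) :=
          ((hcont r hrI.2).continuousAt (Iic_mem_nhds hrs)).tendsto.mono_left nhdsWithin_le_nhds
        have h1 : ∀ᶠ r' in 𝓝[>] r, r' ∈ H := nhdsWithin_le_nhds (hH.mem_nhds hr)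
        have h2 : ∀ᶠ r' in 𝓝[>] r, r' < s := nhdsWithin_le_nhds (Iio_mem_nhds hrs)
        obtain ⟨r', ⟨⟨h1, h2⟩, h3⟩, h4⟩ :=
          (((h1.and h2).and (h0.eventually_lt_const hc)).and self_mem_nhdsWithin).exists
        exact ⟨r', h1, hrI.1.trans_lt h4, h2, h3⟩
    exact h.eventually_le_open_of_mem_Ioo hj hstrict hH hr'H hr'γ hr's hr'c

theorem satisfiesLDP (h : TailEstimates P X γ s)
    (hj : ∀ r < s, Tendsto (fun N : ℕ => -Real.log (P.real {ω | N * r ≤ X N ω}) / N) atTop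
      (𝓝 (j r))) (hcont : ContinuousOn j (Iic s)) (hmono : MonotoneOn j (Iic s))
    (hstrict : StrictMonoOn j (Icc γ s)) (hzero : j γ = 0) {R : ℝ → EReal}
    (hR : ∀ r ∈ Icc γ s, R r = (j r : EReal)) (hR' : ∀ r ∉ Icc γ s, R r = ⊤) :
    SatisfiesLDP P (fun N ω => X N ω / (N : ℝ)) R where
  nonneg r := by
    by_cases hr : r ∈ Icc γ s
    · rw [hR r hr]
      exact_mod_cast hzero ▸ hmono h.le hr.2 hr.1
    · rw [hR' r hr]; exact le_top
  lowerSemicontinuous := by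
    refine lowerSemicontinuous_iff_isClosed_preimage.2 fun a => ?_
    induction a with
    | top => simp
    | bot =>
      convert! isClosed_empty (X := ℝ)
      refine eq_empty_of_forall_notMem fun r hr => ?_
      rw [mem_preimage, mem_Iic, le_bot_iff] at hr
      by_cases hrI : r ∈ Icc γ s
      · rw [hR r hrI] at hr; exact EReal.coe_ne_bot _ hr
      · rw [hR' r hrI] at hr; exact top_ne_bot hr
    | coe a =>
      have : R ⁻¹' Iic (a : EReal) = Icc γ s ∩ j ⁻¹' Iic a := by
        ext r
        by_cases hrI : r ∈ Icc γ s
        · simp only [mem_preimage, mem_Iic, hR r hrI, EReal.coe_le_coe_iff, mem_inter_iff, hrI,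
            true_and]
        · simp only [mem_preimage, mem_Iic, hR' r hrI, mem_inter_iff, hrI, false_and, iff_false,
            top_le_iff]
          exact EReal.coe_ne_top a
      rw [this]
      exact (hcont.mono fun r hr => hr.2).preimage_isClosed_of_isClosed isClosed_Icc isClosed_Iic
  upper F hF := by
    rw [EReal.le_neg]
    refine EReal.ge_of_forall_gt_iff_ge.1 fun c hc => ?_
    obtain ⟨c', hc1, hc2⟩ := EReal.lt_iff_exists_real_btwn.1 hc
    have h1 := h.eventually_closed_le hj hcont hzero hF (c := c) (c' := c') (fun r hr => by
      have h2 := hc2.le.trans (iInf₂_le r hr.1)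
      rw [hR r hr.2] at h2
      exact_mod_cast h2) (by exact_mod_cast hc1)
    rw [EReal.le_neg]
    refine limsup_le_of_le (by isBoundedDefault) ?_
    filter_upwards [h1, eventually_gt_atTop 0] with N h1 h2
    exact scaledLog_le h2 h1
  lower H hH := by
    rw [EReal.neg_le]
    refine le_iInf₂ fun r hr => ?_
    by_cases hrI : r ∈ Icc γ s
    · rw [hR r hrI]
      refine EReal.le_of_forall_lt_iff_le.1 fun c hc => ?_
      rw [EReal.neg_le]
      refine le_liminf_of_le (by isBoundedDefault) ?_
      filter_upwards [h.eventually_le_open hj hcont hmono hstrict hzero hH hr hrI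
        (by exact_mod_cast hc), eventually_gt_atTop 0] with N h1 h2
      exact le_scaledLog h2 h1
    · rw [hR' r hrI]; exact le_top

end TailEstimates

end BernoulliLPP

theorem theorem3p3 {Ω : Type*} [MeasurableSpace Ω] (P : Measure Ω) [IsProbabilityMeasure P]
    (p : unitInterval) (hp0 : 0 < (p : ℝ)) (hp1 : (p : ℝ) < 1)
    (ω : ℕ × ℕ → Ω → ℝ)
    (hlaw : ∀ v, HasLaw (ω v) (bernoulliMeasure (1 : ℝ) 0 p) P)
    (hindep : iIndepFun ω P)
    (s t : ℝ) (hs : 0 < s) (ht : 0 < t) :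
    -- `J` is the right-tail rate function: the limit exists for `0 ≤ r < s`,
    -- and `J` is extended continuously to `r = s`
    (∀ r, 0 ≤ r → r < s →
      Tendsto (fun N : ℕ =>
          -BernoulliLPP.scaledLog P N {x | (N : ℝ) * r ≤ BernoulliLPP.G ω s t N x})
        atTop (𝓝 (BernoulliLPP.J P ω s t r))) ∧
    Tendsto (BernoulliLPP.J P ω s t) (𝓝[<] s) (𝓝 (BernoulliLPP.J P ω s t s)) ∧
    -- the large deviation principle at speed `N`, with a good rate function
    BernoulliLPP.SatisfiesLDP P (fun N x => BernoulliLPP.G ω s t N x / (N : ℝ))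
      (BernoulliLPP.I P ω p s t) ∧
    (∀ a : ℝ, IsCompact {r | BernoulliLPP.I P ω p s t r ≤ (a : EReal)}) ∧
    -- regularity on `[g_pp(s,t), s]`
    (∀ r ∈ Icc (BernoulliLPP.shape p s t) s,
      BernoulliLPP.I P ω p s t r ≠ ⊤ ∧ BernoulliLPP.I P ω p s t r ≠ ⊥) ∧
    StrictMonoOn (BernoulliLPP.I P ω p s t) (Icc (BernoulliLPP.shape p s t) s) ∧
    ContinuousOn (BernoulliLPP.I P ω p s t) (Icc (BernoulliLPP.shape p s t) s) ∧
    ConvexOn ℝ (Icc (BernoulliLPP.shape p s t) s)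
      (fun r => (BernoulliLPP.I P ω p s t r).toReal) ∧
    -- the unique zero
    (∀ r, BernoulliLPP.I P ω p s t r = 0 ↔ r = BernoulliLPP.shape p s t) := by
  have h := BernoulliLPP.tailEstimates_G P p hp0 hp1 ω hlaw hindep s t hs ht
  obtain ⟨j, hj, hjs, hcont, hconv, hmono, hstrict, hzero⟩ := h.exists_rate
  set γ := BernoulliLPP.shape p s t
  have hlim (r : ℝ) (hr : r < s) : Tendsto (fun N : ℕ =>
      -BernoulliLPP.scaledLog P N {x | (N : ℝ) * r ≤ BernoulliLPP.G ω s t N x}) atTop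
        (𝓝 (j r : EReal)) := by
    refine ((continuous_coe_real_ereal.tendsto _).comp (hj r hr)).congr' ?_
    obtain ⟨c, hc⟩ := h.lower_rate
    obtain ⟨N₀, hN₀⟩ := hc r hr
    filter_upwards [eventually_ge_atTop N₀] with N hN
    rw [BernoulliLPP.scaledLog_eq ((Real.exp_pos _).trans_le (hN₀ N hN)), ← EReal.coe_neg,
      ← neg_div]
    rfl
  have hdecay (r : ℝ) (hr : r < s) : BernoulliLPP.decayRate P ω s t r = (j r : EReal) :=
    (hlim r hr).liminf_eq
  have hJlim : Tendsto (fun r => (j r : EReal)) (𝓝[<] s) (𝓝 (j s : EReal)) :=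
    (continuous_coe_real_ereal.tendsto _).comp hjs
  have hJ (r : ℝ) (hr : r ≤ s) : BernoulliLPP.J P ω s t r = (j r : EReal) := by
    rcases hr.lt_or_eq with hr | rfl
    · rw [BernoulliLPP.J, if_pos hr, hdecay r hr]
    · rw [BernoulliLPP.J, if_neg (lt_irrefl r), if_pos rfl]
      refine (hJlim.congr' ?_).liminf_eq
      filter_upwards [self_mem_nhdsWithin] with r' hr'
      exact (hdecay r' hr').symm
  have hI (r : ℝ) (hr : r ∈ Icc γ s) : BernoulliLPP.I P ω p s t r = (j r : EReal) := by
    rw [BernoulliLPP.I, if_pos hr, hJ r hr.2]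
  have hI' (r : ℝ) (hr : r ∉ Icc γ s) : BernoulliLPP.I P ω p s t r = ⊤ := by
    rw [BernoulliLPP.I, if_neg hr]
  have hLDP := h.satisfiesLDP hj hcont hmono hstrict hzero hI hI'
  refine ⟨fun r _ hr => ?_, ?_, hLDP, fun a => ?_, fun r hr => ?_, fun x hx y hy hxy => ?_, ?_, ?_,
    fun r => ⟨fun hr => ?_, ?_⟩⟩
  · rw [hJ r hr.le]; exact hlim r hr
  · rw [hJ s le_rfl]
    refine hJlim.congr' ?_
    filter_upwards [self_mem_nhdsWithin] with r hr
    exact (hJ r (mem_Iio.1 hr).le).symm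
  · refine (isCompact_Icc (a := γ) (b := s)).of_isClosed_subset
      (hLDP.lowerSemicontinuous.isClosed_preimage (a : EReal)) fun r hr => ?_
    by_contra hrI
    rw [mem_ofPred_eq, hI' r hrI] at hr
    exact EReal.coe_ne_top a (top_le_iff.1 hr)
  · rw [hI r hr]
    exact ⟨EReal.coe_ne_top _, EReal.coe_ne_bot _⟩
  · rw [hI x hx, hI y hy]
    exact_mod_cast hstrict hx hy hxy
  · exact (continuous_coe_real_ereal.comp_continuousOn
      (hcont.mono fun r hr => hr.2)).congr fun r hr => hI r hr
  · exact (hconv.subset (fun r hr => hr.2) (convex_Icc γ s)).congr fun r hr => by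
      rw [hI r hr, EReal.toReal_coe]
  · by_cases hrI : r ∈ Icc γ s
    · rw [hI r hrI] at hr
      refine hstrict.injOn hrI ⟨le_rfl, h.le⟩ ?_
      rw [hzero]
      exact_mod_cast hr
    · rw [hI' r hrI] at hr
      exact absurd hr EReal.top_ne_zero
  · rintro rfl
    rw [hI _ ⟨le_rfl, h.le⟩, hzero, EReal.coe_zero]
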